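/- Let $N\ge 2$. Consider a quantum network with nodes Alice ($A$), a router ($C$) and $N-1$ parties $B_1,\dots,B_{N-1}$ (the Bobs), and directed channels $A\to C$ and $C\to B_i$ ($1\le i\le N-1$). In one network use every channel transmits at most one qubit. Initially every node holds only local qubits in the state $|0\rangle$. All nodes may perform arbitrary local quantum operations between transmissions; the statements below hold both without classical communication and with free classical communication between all nodes. For a pure state, $E_{A|B}$ denotes the entropy of entanglement, i.e. the von Neumann entropy in bits of the reduced state of one side of the cut $A|B$, where $B$ consists of the router and all Bobs. An $N$-party GHZ state is $(|0\rangle^{\otimes N}+|1\rangle^{\otimes N})/\sqrt2$, and "$N-1$ Bell pairs" means one Bell pair $(|00\rangle+|11\rangle)/\sqrt2$ shared by $A$ and $B_i$ for each $i$. 1. Moving one qubit of a pure state from one side of a cut to the other raises the entropy of entanglement by at most $1$. Moreover, a pure state that can be distributed by sending $k$ qubits from $A$ to $B$ (even if all of $B$ may act jointly) has $E_{A|B}\le k$; in particular $E_{A|B}\le 1$ if a single qubit is sent. 2. $N-1$ Bell pairs have $E_{A|B}=N-1$. 3. If $N\ge 3$, then $N-1$ Bell pairs cannot be distributed by a protocol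 in which at most one qubit is sent from Alice to the router, however often the channels $C\to B_i$ are used, and not even if the router and all Bobs act jointly as a single party. 4. The smallest number of network uses with which $N-1$ Bell pairs can be distributed (one round of the bipartite protocol, 2QKD) is exactly $N-1$. The smallest number of network uses with which the $N$-party GHZ state can be distributed (one round of the multipartite protocol, NQKD) is exactly $1$. 5. For $n\ge1$ Bobs sharing a state $\rho$ with Alice, let the asymptotic secret fraction be $$r_\infty=\sup_{U\leftarrow K}\ \inf_{\sigma\in\Gamma}\Bigl[S(U|E)-\max_{1\le i\le n}H(U|K_i)\Bigr].$$ Here $K$ and $K_i$ are the $Z$-measurement outcomes of Alice and of Bob $i$, $U\leftarrow K$ is a bit channel, $E$ purifies $\sigma$, and $\Gamma$ is the set of states with the same values as $\rho$ of three kinds of error rates: $Q_Z=\Pr[\exists i: K_i\ne K]$, $Q_{AB_i}=\Pr[K_i\neq K]$, and $Q_X=(1-\langle X^{\otimes (n+1)}\rangle_{\rm dep})/2$, where $\langle X^{\otimes(n+1)}\rangle_{\rm dep}$ is the average, over all choices of $X$ or $Y$ for each party with an even number $\kappa$ of $Y$'s, of $(-1)^{\kappa/2}$ times the expectation of the product of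 the outcomes. Let the key rate be $R=r_\infty/t_{\rm rep}$, where $t_{\rm rep}$ is the smallest number of network uses that distributes the resource state of one round (one network use per unit of time). For 2QKD, $r_\infty$ is the minimum over $i$ of the secret fractions of the two-party keys obtained from the Bell pairs. In the ideal case, i.e. if the GHZ state, respectively the $N-1$ Bell pairs, are shared perfectly, $r_\infty=1$ for both protocols, and $R^{\rm NQKD}=(N-1)\,R^{\rm 2QKD}$ with $R^{\rm 2QKD}>0$. -/

import Mathlib

open scoped Matrix

namespace ConferenceQKD

noncomputable section

open Classical

/-! ## Registers of qubits

A register of qubits labelled by a finite type `Q` has the computational basis `Q → Bool`.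
Vectors are functions `(Q → Bool) → ℂ`, operators and states are matrices over the basis. -/

/-- Operators on a register of qubits labelled by `Q`. -/
abbrev QOp (Q : Type) := Matrix (Q → Bool) (Q → Bool) ℂ

/-- The operator `|ψ⟩⟨ψ|`. -/
def pureState {ι : Type} (ψ : ι → ℂ) : Matrix ι ι ℂ :=
  Matrix.of fun x y => ψ x * star (ψ y)

/-- The vector `|0…0⟩`. -/
def zeroVec (Q : Type) : (Q → Bool) → ℂ :=
  fun x => if x = fun _ => false then 1 else 0

/-- The reduced operator of `ρ` on the qubits `τ t` (relabelled by `t : T`): the partial trace over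
all qubits outside the range of `τ`. -/
def reduce {Q T : Type} [Fintype Q] (τ : T ↪ Q) (ρ : QOp Q) : QOp T :=
  Matrix.of fun a a' => ∑ x : Q → Bool, ∑ x' : Q → Bool,
    if (∀ t, x (τ t) = a t) ∧ (∀ t, x' (τ t) = a' t) ∧ (∀ q, q ∉ Set.range τ → x q = x' q)
    then ρ x x' else 0

/-! ## Entropies, in bits -/

/-- Shannon entropy of a distribution on a finite set. -/
def shannonEntropy {ι : Type} [Fintype ι] (p : ι → ℝ) : ℝ :=
  (∑ i, Real.negMulLog (p i)) / Real.log 2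

/-- Von Neumann entropy `- tr (ρ log₂ ρ)` of a density operator, through its eigenvalues
(the value on a non-Hermitian matrix is irrelevant). -/
def vonNeumannEntropy {ι : Type} [Fintype ι] (ρ : Matrix ι ι ℂ) : ℝ :=
  if h : ρ.IsHermitian then shannonEntropy h.eigenvalues else 0

/-- Entropy of entanglement of the pure state `ψ` across the cut of the register into the qubits
in `A` and the qubits outside `A`. -/
def entanglementEntropy {Q : Type} [Fintype Q] (A : Finset Q) (ψ : (Q → Bool) → ℂ) : ℝ :=
  vonNeumannEntropy (reduce (Function.Embedding.subtype (fun q => q ∈ A)) (pureState ψ))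

/-! ## Protocols in a quantum network

A network has nodes `V` and directed channels `C`, with end points given by `src` and `tgt`.
Every qubit is held by a node; `o : Q → V` says by which. -/

/-- `K` acts on the qubits held by node `v` only (as the identity on all others). -/
def IsLocalAt {V Q : Type} (o : Q → V) (v : V) (K : QOp Q) : Prop :=
  ∃ K' : QOp {q : Q // o q = v}, ∀ x y : Q → Bool,
    K x y = if (∀ q, o q ≠ v → x q = y q) then K' (fun q => x q) (fun q => y q) else 0

/-- `Run src tgt cc cs o ρ o' σ`: there is a protocol that starts with the qubits located according
to `o` in the (possibly subnormalised) state `ρ`, ends with the qubits located according to `o'` in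
the state `σ`, and transmits qubits over the channels in the list `cs`, in this order, one qubit for
each entry. Between transmissions the nodes may perform arbitrary local quantum instruments. An
instrument has Kraus operators `K k l`, where the outcome `l` is discarded and the outcome `k` is
announced to all nodes, which may let their later operations depend on it. Nontrivial announcements
are permitted only if `cc = true` (free classical communication between all nodes). -/
inductive Run {V C Q : Type} [Fintype Q] (src tgt : C → V) (cc : Bool) :
    List C → (Q → V) → QOp Q → (Q → V) → QOp Q → Prop
  | done (o : Q → V) (ρ : QOp Q) : Run src tgt cc [] o ρ o ρ
  | localOp {cs : List C} {o o' : Q → V} {ρ : QOp Q} (v : V) (a b : ℕ)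
      (K : Fin a → Fin b → QOp Q) (hlocal : ∀ k l, IsLocalAt o v (K k l))
      (htrace : ∑ k, ∑ l, (K k l)ᴴ * K k l = 1) (hcc : cc = true ∨ a = 1)
      (σ : Fin a → QOp Q)
      (hrest : ∀ k, Run src tgt cc cs o (∑ l, K k l * ρ * (K k l)ᴴ) o' (σ k)) :
      Run src tgt cc cs o ρ o' (∑ k, σ k)
  | send {cs : List C} {o o' : Q → V} {ρ σ : QOp Q} (c : C) (q : Q) (hq : o q = src c)
      (hrest : Run src tgt cc cs (Function.update o q (tgt c)) ρ o' σ) :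
      Run src tgt cc (c :: cs) o ρ o' σ

/-- By transmitting qubits over the channels `cs` (one for each entry, in this order) one can
distribute the state `ρ` of qubits labelled by `T`, with qubit `t` ending at node `loc t`. Initially
there is no entanglement or correlation: every node holds any number of local qubits in `|0⟩`. -/
def Distributes {V C T : Type} (src tgt : C → V) (cc : Bool) (cs : List C)
    (loc : T → V) (ρ : QOp T) : Prop :=
  ∃ (n : ℕ) (o o' : Fin n → V) (σ : QOp (Fin n)) (τ : T ↪ Fin n),
    Run src tgt cc cs o (pureState (zeroVec (Fin n))) o' σ ∧
    (∀ t, o' (τ t) = loc t) ∧ reduce τ σ = ρ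

/-- The state can be distributed with `n` uses of the network. In a single use every channel
transmits at most one qubit (in any order, with local operations in between). -/
def DistributesInUses {V C T : Type} (src tgt : C → V) (cc : Bool) (n : ℕ)
    (loc : T → V) (ρ : QOp T) : Prop :=
  ∃ L : List (List C), L.length = n ∧ (∀ l ∈ L, l.Nodup) ∧
    Distributes src tgt cc L.flatten loc ρ

/-! ### The network with a central router -/

/-- Alice, the router and `m` Bobs. -/
inductive Node (m : ℕ) : Type
  | alice : Node m
  | router : Node m
  | bob (i : Fin m) : Node m

/-- Channels: `none` goes from Alice to the router, `some i` from the router to Bob `i`. -/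
abbrev Channel (m : ℕ) := Option (Fin m)

def chanSrc (m : ℕ) : Channel m → Node m
  | none => Node.alice
  | some _ => Node.router

def chanTgt (m : ℕ) : Channel m → Node m
  | none => Node.router
  | some i => Node.bob i

/-! ### The two-party network obtained by grouping the router and all Bobs into one party -/

inductive Side : Type
  | A : Side
  | B : Side

/-- The only channel of the grouped network goes from `A` to `B`. -/
def cutSrc : Unit → Side := fun _ => Side.A

def cutTgt : Unit → Side := fun _ => Side.B

/-- The side of the cut on which a node lies. -/
def side {m : ℕ} : Node m → Side
  | Node.alice => Side.A
  | Node.router => Side.B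
  | Node.bob _ => Side.B

/-! ### The resource states -/

/-- The `2m` qubits of `m` pairs: `(i, false)` is Alice's and `(i, true)` is Bob `i`'s. -/
abbrev PairQubit (m : ℕ) := Fin m × Bool

def pairLoc (m : ℕ) : PairQubit m → Node m
  | (_, false) => Node.alice
  | (i, true) => Node.bob i

/-- Alice's qubits in `m` pairs. -/
def alicePairQubits (m : ℕ) : Finset (PairQubit m) :=
  Finset.univ.filter fun t => t.2 = false

/-- `m` Bell pairs: the tensor product over `i` of `(|00⟩ + |11⟩)/√2` on Alice's `i`-th qubit and
Bob `i`'s qubit. -/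
def bellPairs (m : ℕ) : (PairQubit m → Bool) → ℂ :=
  fun x => ∏ i : Fin m, if x (i, false) = x (i, true) then (1 / (Real.sqrt 2 : ℂ)) else 0

/-- One qubit for Alice (`none`) and one for each of `m` Bobs (`some i`). -/
abbrev PartyQubit (m : ℕ) := Option (Fin m)

def partyLoc (m : ℕ) : PartyQubit m → Node m
  | none => Node.alice
  | some i => Node.bob i

/-- The state `(|0…0⟩ + |1…1⟩)/√2` of `m + 1` qubits. -/
def ghz (m : ℕ) : (PartyQubit m → Bool) → ℂ :=
  fun x => if (∀ t, x t = false) ∨ (∀ t, x t = true) then (1 / (Real.sqrt 2 : ℂ)) else 0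

/-! ## The asymptotic secret fraction

The key bit `K` is Alice's outcome of a `Z`-measurement, `K_i` is the outcome of Bob `i`. -/

/-- `Q_Z`: the probability that at least one Bob has a `Z`-outcome different from Alice's. -/
def errZ {m : ℕ} (σ : QOp (PartyQubit m)) : ℝ :=
  ∑ x : PartyQubit m → Bool, if (∃ i, x (some i) ≠ x none) then (σ x x).re else 0

/-- `Q_{AB_i}`: the probability that the `Z`-outcome of Bob `i` differs from Alice's. -/
def errAB {m : ℕ} (σ : QOp (PartyQubit m)) (i : Fin m) : ℝ :=
  ∑ x : PartyQubit m → Bool, if x (some i) ≠ x none then (σ x x).re else 0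

/-- The Pauli operators `X` and `Y`. -/
def pauliX (a b : Bool) : ℂ := if a = b then 0 else 1

def pauliY (a b : Bool) : ℂ := if a = b then 0 else if a then Complex.I else -Complex.I

/-- The product measurement in which the parties `t` with `y t = true` measure `Y` and the others
measure `X`. -/
def pauliXY {m : ℕ} (y : PartyQubit m → Bool) : QOp (PartyQubit m) :=
  Matrix.of fun a b => ∏ t, if y t then pauliY (a t) (b t) else pauliX (a t) (b t)

/-- Number of parties that measure `Y`. -/
def numY {m : ℕ} (y : PartyQubit m → Bool) : ℕ := (Finset.univ.filter fun t => y t = true).card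

/-- The expectation value of `X ⊗ ⋯ ⊗ X` after depolarisation, as obtained from the second-type
measurements: the average over the `2 ^ m` settings with an even number `κ` of `Y`-measurements,
with sign `+` if `4 ∣ κ` and `-` otherwise. -/
def depolarisedX {m : ℕ} (σ : QOp (PartyQubit m)) : ℝ :=
  (∑ y : PartyQubit m → Bool,
    if Even (numY y) then (-1 : ℝ) ^ (numY y / 2) * (Matrix.trace (σ * pauliXY y)).re else 0)
    / 2 ^ m

/-- `Q_X`: the probability of an unexpected result of the `X`-measurement. -/
def errX {m : ℕ} (σ : QOp (PartyQubit m)) : ℝ := (1 - depolarisedX σ) / 2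

/-- `σ` and `ρ` give the same result in the parameter estimation. -/
def SameParameters {m : ℕ} (σ ρ : QOp (PartyQubit m)) : Prop :=
  errZ σ = errZ ρ ∧ errX σ = errX ρ ∧ ∀ i, errAB σ i = errAB ρ i

/-- The state of Alice and the Bobs if the global pure state with Eve is `ψ`. -/
def honestState {m d : ℕ} (ψ : (PartyQubit m → Bool) × Fin d → ℂ) : QOp (PartyQubit m) :=
  Matrix.of fun x x' => ∑ e, ψ (x, e) * star (ψ (x', e))

/-- Eve's state. -/
def eveState {m d : ℕ} (ψ : (PartyQubit m → Bool) × Fin d → ℂ) : Matrix (Fin d) (Fin d) ℂ :=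
  Matrix.of fun e e' => ∑ x, ψ (x, e) * star (ψ (x, e'))

/-- A bitwise preprocessing channel `U ← K`: `w k u` is the probability of `u` given `k`. -/
def IsBitChannel (w : Bool → Bool → ℝ) : Prop :=
  (∀ k u, 0 ≤ w k u) ∧ ∀ k, ∑ u, w k u = 1

/-- The joint state of the classical bit `U` and Eve. -/
def bitEveState {m d : ℕ} (w : Bool → Bool → ℝ) (ψ : (PartyQubit m → Bool) × Fin d → ℂ) :
    Matrix (Bool × Fin d) (Bool × Fin d) ℂ :=
  Matrix.of fun p p' =>
    if p.1 = p'.1 then ∑ x, (w (x none) p.1 : ℂ) * (ψ (x, p.2) * star (ψ (x, p'.2))) else 0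

/-- The conditional von Neumann entropy `S(U|E)`. -/
def condEntropyEve {m d : ℕ} (w : Bool → Bool → ℝ)
    (ψ : (PartyQubit m → Bool) × Fin d → ℂ) : ℝ :=
  vonNeumannEntropy (bitEveState w ψ) - vonNeumannEntropy (eveState ψ)

/-- The joint distribution of `U` and the `Z`-outcome `K_i` of Bob `i`. -/
def bitBobDist {m : ℕ} (w : Bool → Bool → ℝ) (σ : QOp (PartyQubit m)) (i : Fin m) :
    Bool × Bool → ℝ :=
  fun p => ∑ x : PartyQubit m → Bool, if x (some i) = p.2 then w (x none) p.1 * (σ x x).re else 0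

/-- The conditional Shannon entropy `H(U|K_i)`. -/
def condEntropyBob {m : ℕ} (w : Bool → Bool → ℝ) (σ : QOp (PartyQubit m)) (i : Fin m) : ℝ :=
  shannonEntropy (bitBobDist w σ i) - shannonEntropy fun b => ∑ u, bitBobDist w σ i (u, b)

/-- The asymptotic secret fraction
`r_∞ = sup_{U ← K} inf_{σ ∈ Γ} [S(U|E) - max_i H(U|K_i)]` of `m + 1` parties sharing `ρ`, where `Γ`
is the set of states that agree with `ρ` in the parameter estimation, and Eve holds a purification
of `σ`. -/
def secretFraction {m : ℕ} (ρ : QOp (PartyQubit m)) : ℝ :=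
  sSup {r : ℝ | ∃ w : Bool → Bool → ℝ, IsBitChannel w ∧
    r = sInf {s : ℝ | ∃ (d : ℕ) (ψ : (PartyQubit m → Bool) × Fin d → ℂ),
      (∑ p, ‖ψ p‖ ^ 2 = 1) ∧ SameParameters (honestState ψ) ρ ∧
      s = condEntropyEve w ψ - ⨆ i : Fin m, condEntropyBob w (honestState ψ) i}}

/-! ## Key rates in the router network -/

/-- The two qubits of the `i`-th pair, seen as the qubits of Alice and a single Bob. -/
def pairEmb (m : ℕ) (i : Fin m) : PartyQubit 1 ↪ PairQubit m where
  toFun t := (i, t.isSome)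
  inj' := by
    intro s t h
    have h' : s.isSome = t.isSome := congrArg Prod.snd h
    cases s with
    | none => cases t with
      | none => rfl
      | some _ => simp at h'
    | some a => cases t with
      | none => simp at h'
      | some b => rw [Subsingleton.elim a b]

/-- Secret fraction of the multipartite protocol in the ideal case: the parties share GHZ states. -/
def secretFractionNQKD (m : ℕ) : ℝ := secretFraction (pureState (ghz m))

/-- Secret fraction of the bipartite protocol in the ideal case: Alice establishes a key with each
Bob by means of the Bell pair shared with him; the conference key is sent encrypted with each of
these keys, so its length is the length of the shortest of them. -/
def secretFraction2QKD (m : ℕ) : ℝ :=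
  ⨅ i : Fin m, secretFraction (reduce (pairEmb m i) (pureState (bellPairs m)))

/-- Numbers of network uses with which the GHZ state can be distributed to Alice and the Bobs. -/
def usesNQKD (cc : Bool) (m : ℕ) : Set ℕ :=
  {n | DistributesInUses (chanSrc m) (chanTgt m) cc n (partyLoc m) (pureState (ghz m))}

/-- Numbers of network uses with which one Bell pair for Alice and each Bob can be distributed. -/
def uses2QKD (cc : Bool) (m : ℕ) : Set ℕ :=
  {n | DistributesInUses (chanSrc m) (chanTgt m) cc n (pairLoc m) (pureState (bellPairs m))}

/-- The key rate `R = r_∞ / t_rep`, where the time of a round is the smallest number of network uses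
that distributes the resource state of the round (one network use per unit of time). -/
def keyRateNQKD (cc : Bool) (m : ℕ) : ℝ := secretFractionNQKD m / (sInf (usesNQKD cc m) : ℕ)

def keyRate2QKD (cc : Bool) (m : ℕ) : ℝ := secretFraction2QKD m / (sInf (uses2QKD cc m) : ℕ)

end

end ConferenceQKD

open ConferenceQKD

/-! Lower bounds on network uses come from Schmidt rank. The initial all-zero state is a product. A
local Kraus operator changes only one factor of each term in a product decomposition. A qubit
crossing the cut splits each term in two, according to its value. Hence every run that starts from
zeros yields a mixture of pure states of Schmidt rank at most `2 ^ k`, where `k` counts the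
transmissions across Alice's cut. Announced outcomes only sort the terms of this mixture, so
classical communication does not help (`Run.hasSchmidtNumberLE`). If the delivered state is pure,
every nonzero term is proportional to it, so it inherits the rank bound
(`HasSchmidtRankLE.of_reduce`). Entropy is at most the logarithm of the rank, hence at most `k`.
Bell pairs have a flat spectrum and entropy `m`, and each use of the network crosses the cut at most
once, so `m` uses are needed. A GHZ state is not a product, so it needs at least one use.

The matching protocols announce nothing. For Bell pairs, Alice prepares all of them and forwards one
half per use. For GHZ, she sends half of one Bell pair, the router copies it onto fresh qubits by
controlled negations, and each Bob receives one qubit.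

The one-qubit entropy inequality is separate. The two sides of a pure state have equal entropy, so
it suffices that tracing out one qubit lowers the entropy of the complementary side by at most one.
This follows by measuring in the eigenbasis of the marginal together with the computational basis of
the qubit.

For the secret fraction, `Q_Z = 0` confines the state to the two constant strings and `Q_X = 0`
makes their Eve-vectors equal. Eve therefore factors out (`eq_ghz_mul_of_sameParameters`), the
infimum runs over a single value, and that value is the mutual information of `U` and a uniform bit.
It is at most one, with equality for the identity channel. -/

namespace ConferenceQKD

open Classical ComplexOrder

/-! ## Entropy of matrices -/

section Entropy

variable {ι κ : Type} [Fintype ι] [Fintype κ]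

/-- In this form any relation between characteristic polynomials transfers to entropies, with no
matching of ordered eigenvalues. -/
theorem vonNeumannEntropy_eq_roots [inst : DecidableEq ι] {ρ : Matrix ι ι ℂ}
    (h : ρ.IsHermitian) :
    vonNeumannEntropy ρ =
      (ρ.charpoly.roots.map fun z : ℂ => Real.negMulLog z.re).sum / Real.log 2 := by
  obtain rfl : inst = fun a b => Classical.propDecidable (a = b) := Subsingleton.elim _ _
  rw [vonNeumannEntropy, dif_pos h, h.roots_charpoly_eq_eigenvalues, Multiset.map_map]
  simp [shannonEntropy, Function.comp_def]

/-- The characteristic polynomials of the two products agree up to powers of `X`, and a zero root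
contributes `negMulLog 0 = 0`. This gives both equality of the entropies of the two sides of a cut
and invariance under unitary conjugation. -/
theorem vonNeumannEntropy_mul_comm (A : Matrix ι κ ℂ) (B : Matrix κ ι ℂ)
    (hAB : (A * B).IsHermitian) (hBA : (B * A).IsHermitian) :
    vonNeumannEntropy (A * B) = vonNeumannEntropy (B * A) := by
  rw [vonNeumannEntropy_eq_roots hAB, vonNeumannEntropy_eq_roots hBA]
  have h := congrArg Polynomial.roots (Matrix.charpoly_mul_comm' A B)
  rw [Polynomial.roots_mul, Polynomial.roots_mul, Polynomial.roots_X_pow,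
    Polynomial.roots_X_pow] at h
  · have h' := congrArg (fun s => (s.map fun z : ℂ => Real.negMulLog z.re).sum) h
    simp only [Multiset.map_add, Multiset.sum_add, Multiset.map_nsmul, Multiset.sum_nsmul,
      Multiset.map_singleton, Multiset.sum_singleton, Complex.zero_re, Real.negMulLog_zero,
      smul_zero, zero_add] at h'
    rw [h']
  · exact mul_ne_zero (pow_ne_zero _ Polynomial.X_ne_zero) (Matrix.charpoly_monic _).ne_zero
  · exact mul_ne_zero (pow_ne_zero _ Polynomial.X_ne_zero) (Matrix.charpoly_monic _).ne_zero

theorem vonNeumannEntropy_diagonal [DecidableEq ι] (d : ι → ℝ) :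
    vonNeumannEntropy (Matrix.diagonal fun i => (d i : ℂ)) = shannonEntropy d := by
  have h : (Matrix.diagonal fun i => (d i : ℂ)).IsHermitian := by
    rw [Matrix.isHermitian_diagonal_iff]
    intro i
    exact Complex.conj_ofReal _
  rw [vonNeumannEntropy_eq_roots h, Matrix.charpoly_diagonal, Polynomial.roots_prod]
  · simp [shannonEntropy]
  · exact Finset.prod_ne_zero_iff.mpr fun i _ => Polynomial.X_sub_C_ne_zero _

theorem vonNeumannEntropy_submatrix_equiv (e : κ ≃ ι) {ρ : Matrix ι ι ℂ} (h : ρ.IsHermitian) :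
    vonNeumannEntropy (ρ.submatrix e e) = vonNeumannEntropy ρ := by
  rw [vonNeumannEntropy_eq_roots h, vonNeumannEntropy_eq_roots (h.submatrix e)]
  have := Matrix.charpoly_reindex e.symm ρ
  rw [Matrix.reindex_apply] at this
  rw [← this]
  rfl

/-- The diagonal of a state in any basis has at least the entropy of the state. -/
theorem vonNeumannEntropy_le_diag {σ : Matrix ι ι ℂ} (h : σ.PosSemidef) :
    vonNeumannEntropy σ ≤ shannonEntropy fun i => (σ i i).re := by
  have hH := h.isHermitian
  rw [vonNeumannEntropy, dif_pos hH]
  unfold shannonEntropy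
  refine div_le_div_of_nonneg_right ?_ (Real.log_nonneg (by norm_num))
  set U : Matrix ι ι ℂ := hH.eigenvectorUnitary.1 with hU
  have hU1 : U * Uᴴ = 1 := by
    have := Matrix.mem_unitaryGroup_iff.mp hH.eigenvectorUnitary.2
    simpa [Matrix.star_eq_conjTranspose] using this
  have hU2 : Uᴴ * U = 1 := by
    have := Matrix.mem_unitaryGroup_iff'.mp hH.eigenvectorUnitary.2
    simpa [Matrix.star_eq_conjTranspose] using this
  have hrow : ∀ i, ∑ j, ‖U i j‖ ^ 2 = 1 := by
    intro i
    have := congrFun (congrFun hU1 i) i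
    rw [Matrix.mul_apply, Matrix.one_apply_eq] at this
    have h2 := congrArg Complex.re this
    simpa [Matrix.conjTranspose_apply, Complex.mul_conj, Complex.normSq_eq_norm_sq,
      ← Complex.ofReal_pow] using h2
  have hcol : ∀ j, ∑ i, ‖U i j‖ ^ 2 = 1 := by
    intro j
    have := congrFun (congrFun hU2 j) j
    rw [Matrix.mul_apply, Matrix.one_apply_eq] at this
    have h2 := congrArg Complex.re this
    simpa [Matrix.conjTranspose_apply, mul_comm, Complex.mul_conj, Complex.normSq_eq_norm_sq,
      ← Complex.ofReal_pow] using h2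
  have hdiag : ∀ i, (σ i i).re = ∑ j, ‖U i j‖ ^ 2 • hH.eigenvalues j := by
    intro i
    have hs : σ = U * Matrix.diagonal (fun j => (hH.eigenvalues j : ℂ)) * Uᴴ := by
      conv_lhs => rw [hH.spectral_theorem, Unitary.conjStarAlgAut_apply]
      rfl
    have := congrArg Complex.re (congrFun (congrFun hs i) i)
    rw [this, Matrix.mul_apply, Complex.re_sum]
    refine Finset.sum_congr rfl fun j _ => ?_
    rw [Matrix.mul_diagonal, Matrix.conjTranspose_apply, mul_right_comm,
      Complex.star_def, Complex.mul_conj, Complex.normSq_eq_norm_sq, ← Complex.ofReal_mul,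
      Complex.ofReal_re, smul_eq_mul]
  -- The squared moduli of `U` form a doubly stochastic matrix: the row sums allow Jensen here, the
  -- column sums are used in the final computation.
  have hJ : ∀ i, ∑ j, ‖U i j‖ ^ 2 * Real.negMulLog (hH.eigenvalues j) ≤
      Real.negMulLog (σ i i).re := by
    intro i
    rw [hdiag i]
    exact Real.concaveOn_negMulLog.le_map_sum (fun j _ => by positivity) (hrow i)
      (fun j _ => h.eigenvalues_nonneg j)
  calc ∑ j, Real.negMulLog (hH.eigenvalues j)
      = ∑ j, (∑ i, ‖U i j‖ ^ 2) * Real.negMulLog (hH.eigenvalues j) := by simp [hcol]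
    _ = ∑ i, ∑ j, ‖U i j‖ ^ 2 * Real.negMulLog (hH.eigenvalues j) := by
        simp_rw [Finset.sum_mul]
        exact Finset.sum_comm
    _ ≤ _ := Finset.sum_le_sum fun i _ => hJ i

/-- Midpoint concavity: splitting a weight `a + b` in two gains most when the parts are equal,
namely `(a + b) * log 2`. -/
theorem negMulLog_add_negMulLog_le {a b : ℝ} (ha : 0 ≤ a) (hb : 0 ≤ b) :
    Real.negMulLog a + Real.negMulLog b ≤ Real.negMulLog (a + b) + (a + b) * Real.log 2 := by
  have h := Real.concaveOn_negMulLog.2 (Set.mem_Ici.mpr ha) (Set.mem_Ici.mpr hb)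
    (by norm_num : (0 : ℝ) ≤ 1 / 2) (by norm_num : (0 : ℝ) ≤ 1 / 2) (by norm_num)
  simp only [smul_eq_mul, ← mul_add] at h
  rw [Real.negMulLog_mul] at h
  have h2 : Real.negMulLog (1 / 2) = 1 / 2 * Real.log 2 := by
    rw [Real.negMulLog, one_div, Real.log_inv]; ring
  rw [h2] at h
  linarith

/-- Tracing out a qubit lowers the entropy by at most one. -/
theorem vonNeumannEntropy_le_partialTrace_add {σ : Matrix (ι × Bool) (ι × Bool) ℂ}
    (h : σ.PosSemidef) :
    vonNeumannEntropy σ ≤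
      vonNeumannEntropy (Matrix.of fun i j => ∑ b, σ (i, b) (j, b)) + σ.trace.re := by
  set τ : Matrix ι ι ℂ := Matrix.of fun i j => ∑ b, σ (i, b) (j, b) with hτ
  have hτH : τ.IsHermitian := by
    ext i j
    simp only [hτ, Matrix.conjTranspose_apply, Matrix.of_apply, star_sum]
    exact Finset.sum_congr rfl fun b _ => h.isHermitian.apply _ _
  set U : Matrix ι ι ℂ := hτH.eigenvectorUnitary.1 with hU
  have hU1 : U * Uᴴ = 1 := by
    have := Matrix.mem_unitaryGroup_iff.mp hτH.eigenvectorUnitary.2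
    simpa [Matrix.star_eq_conjTranspose] using this
  have hU2 : Uᴴ * U = 1 := by
    have := Matrix.mem_unitaryGroup_iff'.mp hτH.eigenvectorUnitary.2
    simpa [Matrix.star_eq_conjTranspose] using this
  have hs : τ = U * Matrix.diagonal (fun j => (hτH.eigenvalues j : ℂ)) * Uᴴ := by
    conv_lhs => rw [hτH.spectral_theorem, Unitary.conjStarAlgAut_apply]
    rfl
  have hd : Uᴴ * τ * U = Matrix.diagonal (fun j => (hτH.eigenvalues j : ℂ)) := by
    conv_lhs => rw [hs]
    calc _ = (Uᴴ * U) * Matrix.diagonal (fun j => (hτH.eigenvalues j : ℂ)) * (Uᴴ * U) := by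
          simp only [Matrix.mul_assoc]
      _ = _ := by rw [hU2, Matrix.one_mul, Matrix.mul_one]
  -- The basis change `U ⊗ 1`: in it the diagonal entries of `σ` at `(j, false)` and `(j, true)` add
  -- up to the `j`-th eigenvalue of the marginal. Each eigenvalue is thus split in two, and the
  -- total cost is the trace.
  set W : Matrix (ι × Bool) (ι × Bool) ℂ := Matrix.kroneckerMap (· * ·) U (1 : Matrix Bool Bool ℂ)
    with hW
  have hW1 : W * Wᴴ = 1 := by
    rw [hW, Matrix.conjTranspose_kronecker, ← Matrix.mul_kronecker_mul, hU1,
      Matrix.conjTranspose_one, Matrix.one_mul, Matrix.one_kronecker_one]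
  have hσ' : (Wᴴ * σ * W).PosSemidef := h.conjTranspose_mul_mul_same W
  have hent : vonNeumannEntropy (Wᴴ * σ * W) = vonNeumannEntropy σ := by
    have h2 : W * (Wᴴ * σ) = σ := by rw [← Matrix.mul_assoc, hW1, Matrix.one_mul]
    rw [vonNeumannEntropy_mul_comm _ _ hσ'.isHermitian (by rw [h2]; exact h.isHermitian), h2]
  set d : ι × Bool → ℝ := fun p => ((Wᴴ * σ * W) p p).re with hddef
  have hd0 : ∀ p, 0 ≤ d p := fun p => (Complex.le_def.mp (hσ'.diag_nonneg (i := p))).1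
  have hdsum : ∀ j, d (j, false) + d (j, true) = hτH.eigenvalues j := by
    intro j
    have h1 := congrArg Complex.re (congrFun (congrFun hd j) j)
    rw [Matrix.diagonal_apply_eq, Complex.ofReal_re] at h1
    rw [← h1, hddef, ← Complex.add_re]
    congr 1
    have hb : ∀ b, (Wᴴ * σ * W) (j, b) (j, b) =
        ∑ y, (∑ x, star (U x j) * σ (x, b) (y, b)) * U y j := by
      intro b
      simp only [Matrix.mul_apply, Fintype.sum_prod_type, hW, Matrix.kroneckerMap_apply,
        Matrix.conjTranspose_apply, Matrix.one_apply, mul_ite, mul_one, mul_zero,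
        apply_ite (star : ℂ → ℂ), star_zero, ite_mul, zero_mul, Finset.sum_ite_eq',
        Finset.mem_univ, if_true]
    simp only [hb, Matrix.mul_apply, ← Finset.sum_add_distrib, ← add_mul, ← mul_add, hτ,
      Matrix.of_apply, Fintype.sum_bool, Matrix.conjTranspose_apply]
    refine Finset.sum_congr rfl fun y _ => ?_
    congr 1
    refine Finset.sum_congr rfl fun x _ => ?_
    ring
  have htr : ∑ j, hτH.eigenvalues j = σ.trace.re := by
    have h1 := congrArg Complex.re hτH.trace_eq_sum_eigenvalues
    rw [Complex.re_sum] at h1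
    simp only [RCLike.ofReal, Complex.coe_algebraMap, Complex.ofReal_re] at h1
    rw [← h1]
    simp [hτ, Matrix.trace, Fintype.sum_prod_type]
  rw [← hent]
  refine (vonNeumannEntropy_le_diag hσ').trans ?_
  rw [vonNeumannEntropy, dif_pos hτH, ← htr]
  unfold shannonEntropy
  have hlog : 0 < Real.log 2 := Real.log_pos (by norm_num)
  rw [div_add' _ _ _ hlog.ne']
  refine div_le_div_of_nonneg_right ?_ hlog.le
  rw [Finset.sum_mul, ← Finset.sum_add_distrib, Fintype.sum_prod_type]
  refine Finset.sum_le_sum fun j _ => ?_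
  rw [Fintype.sum_bool, ← hdsum j, add_comm (d (j, false))]
  exact negMulLog_add_negMulLog_le (hd0 _) (hd0 _)

/-- Jensen with uniform weights on the support of `p`; points outside the support contribute
nothing. -/
theorem shannonEntropy_le_logb {p : ι → ℝ} (hp : ∀ i, 0 ≤ p i) (hp1 : ∑ i, p i = 1) {r : ℕ}
    (hr : Fintype.card {i // p i ≠ 0} ≤ r) : shannonEntropy p ≤ Real.logb 2 r := by
  unfold shannonEntropy Real.logb
  refine div_le_div_of_nonneg_right ?_ (Real.log_nonneg (by norm_num))
  set s : Finset ι := Finset.univ.filter fun i => p i ≠ 0 with hs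
  have hcard : s.card ≤ r := by rwa [hs, ← Fintype.card_subtype]
  have hsum1 : ∑ i ∈ s, p i = 1 := by
    rw [← hp1, hs, Finset.sum_filter_ne_zero]
  have hsum : ∑ i, Real.negMulLog (p i) = ∑ i ∈ s, Real.negMulLog (p i) := by
    rw [hs, Finset.sum_filter]
    refine Finset.sum_congr rfl fun i _ => ?_
    by_cases h : p i = 0 <;> simp [h]
  have hs0 : 0 < s.card := by
    rw [Finset.card_pos]
    by_contra hne
    rw [Finset.not_nonempty_iff_eq_empty.mp hne] at hsum1
    simp at hsum1
  have hc : (0 : ℝ) < s.card := by exact_mod_cast hs0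
  have hJ := Real.concaveOn_negMulLog.le_map_sum (t := s) (w := fun _ => (s.card : ℝ)⁻¹) (p := p)
    (fun _ _ => by positivity) (by simp [hc.ne']) (fun i _ => hp i)
  simp only [smul_eq_mul, ← Finset.mul_sum, hsum1, mul_one] at hJ
  rw [hsum]
  have h1 : Real.negMulLog (s.card : ℝ)⁻¹ = (s.card : ℝ)⁻¹ * Real.log s.card := by
    rw [Real.negMulLog, Real.log_inv]; ring
  rw [h1] at hJ
  exact (le_of_mul_le_mul_left hJ (by positivity)).trans
    (Real.log_le_log hc (by exact_mod_cast hcard))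

theorem vonNeumannEntropy_le_logb_rank {ρ : Matrix ι ι ℂ} (h : ρ.PosSemidef)
    (h1 : ρ.trace = 1) {r : ℕ} (hr : ρ.rank ≤ r) : vonNeumannEntropy ρ ≤ Real.logb 2 r := by
  rw [vonNeumannEntropy, dif_pos h.isHermitian]
  refine shannonEntropy_le_logb (fun i => h.eigenvalues_nonneg i) ?_ ?_
  · have h2 := congrArg Complex.re h.isHermitian.trace_eq_sum_eigenvalues
    rw [h1, Complex.re_sum] at h2
    simpa using h2.symm
  · rwa [← h.isHermitian.rank_eq_card_non_zero_eigs]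

end Entropy

/-! ## Joining and splitting registers -/

section Glue

variable {Q T : Type}

/-- The assignment that is `a` on the range of `τ` and `e` elsewhere. -/
noncomputable def glue (τ : T ↪ Q) (a : T → Bool) (e : {q // q ∉ Set.range τ} → Bool) : Q → Bool :=
  fun q => if h : q ∈ Set.range τ then a h.choose else e ⟨q, h⟩

@[simp] theorem glue_apply (τ : T ↪ Q) (a : T → Bool) (e : {q // q ∉ Set.range τ} → Bool) (t : T) :
    glue τ a e (τ t) = a t := by
  have h : τ t ∈ Set.range τ := ⟨t, rfl⟩
  rw [glue, dif_pos h]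
  exact congrArg a (τ.injective h.choose_spec)

@[simp] theorem glue_apply_of_notMem (τ : T ↪ Q) (a : T → Bool)
    (e : {q // q ∉ Set.range τ} → Bool) (q : {q // q ∉ Set.range τ}) : glue τ a e q = e q := by
  rw [glue, dif_neg q.2]

/-- Assignments split into their parts on and off the range of `τ`. -/
noncomputable def glueEquiv (τ : T ↪ Q) :
    (T → Bool) × ({q // q ∉ Set.range τ} → Bool) ≃ (Q → Bool) where
  toFun p := glue τ p.1 p.2
  invFun x := (fun t => x (τ t), fun q => x q)
  left_inv p := by ext <;> simp
  right_inv x := by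
    funext q
    by_cases h : q ∈ Set.range τ
    · obtain ⟨t, rfl⟩ := h
      simp
    · exact glue_apply_of_notMem τ _ _ ⟨q, h⟩

theorem glueEquiv_apply (τ : T ↪ Q) (p) : glueEquiv τ p = glue τ p.1 p.2 := rfl

variable [Fintype Q] [Fintype T]

/-- The constraints in `reduce` leave only the common assignment of the discarded qubits free, so
the double sum becomes a partial trace over one index. -/
theorem reduce_apply [hQ : DecidableEq Q] (τ : T ↪ Q) (ρ : QOp Q) (a a' : T → Bool) :
    reduce τ ρ a a' = ∑ e, ρ (glue τ a e) (glue τ a' e) := by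
  obtain rfl : hQ = fun a b => Classical.propDecidable (a = b) := Subsingleton.elim _ _
  rw [reduce, Matrix.of_apply, ← (glueEquiv τ).sum_comp, Fintype.sum_prod_type]
  have key : ∀ (b : T → Bool) (e : {q // q ∉ Set.range τ} → Bool),
      (∑ x' : Q → Bool, if (∀ t, glueEquiv τ (b, e) (τ t) = a t) ∧ (∀ t, x' (τ t) = a' t) ∧
        (∀ q, q ∉ Set.range τ → glueEquiv τ (b, e) q = x' q)
        then ρ (glueEquiv τ (b, e)) x' else 0) =
      if b = a then ρ (glue τ b e) (glue τ a' e) else 0 := by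
    intro b e
    rw [Finset.sum_eq_single (glue τ a' e)]
    · have h1 : (∀ t, glueEquiv τ (b, e) (τ t) = a t) ↔ b = a := by
        simp [glueEquiv_apply, funext_iff]
      have h2 : ∀ q, q ∉ Set.range τ → glueEquiv τ (b, e) q = glue τ a' e q := by
        intro q hq
        exact (glue_apply_of_notMem τ b e ⟨q, hq⟩).trans
          (glue_apply_of_notMem τ a' e ⟨q, hq⟩).symm
      have h3 : ((∀ t, glueEquiv τ (b, e) (τ t) = a t) ∧ (∀ t, glue τ a' e (τ t) = a' t) ∧
          ∀ q, q ∉ Set.range τ → glueEquiv τ (b, e) q = glue τ a' e q) ↔ b = a :=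
        ⟨fun h => h1.mp h.1, fun h => ⟨h1.mpr h, fun t => glue_apply τ a' e t, h2⟩⟩
      simp only [h3]
      rfl
    · intro x' _ hx'
      rw [if_neg]
      rintro ⟨-, h2, h3⟩
      apply hx'
      funext q
      by_cases h : q ∈ Set.range τ
      · obtain ⟨t, rfl⟩ := h
        simp [h2]
      · rw [← h3 q h]
        exact (glue_apply_of_notMem τ b e ⟨q, h⟩).trans
          (glue_apply_of_notMem τ a' e ⟨q, h⟩).symm
    · simp
  rw [Finset.sum_comm]
  refine Finset.sum_congr rfl fun e _ => ?_
  exact (Finset.sum_congr rfl fun b _ => by convert key b e).trans (by simp)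

theorem trace_reduce [DecidableEq Q] [DecidableEq T] (τ : T ↪ Q) (ρ : QOp Q) :
    (reduce τ ρ).trace = ρ.trace := by
  simp only [Matrix.trace, Matrix.diag_apply, reduce_apply]
  rw [← (glueEquiv τ).sum_comp, Fintype.sum_prod_type]
  rfl

theorem trace_pureState {ι : Type} [Fintype ι] (ψ : ι → ℂ) :
    (pureState ψ).trace = ((∑ x, ‖ψ x‖ ^ 2 : ℝ) : ℂ) := by
  simp [pureState, Matrix.trace, Complex.mul_conj, Complex.normSq_eq_norm_sq]

/-- The amplitudes of `ψ`, as a matrix with respect to a cut of the register. -/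
noncomputable def cutMatrix (τ : T ↪ Q) (ψ : (Q → Bool) → ℂ) :
    Matrix (T → Bool) ({q // q ∉ Set.range τ} → Bool) ℂ :=
  Matrix.of fun a e => ψ (glue τ a e)

theorem reduce_pureState [DecidableEq Q] (τ : T ↪ Q) (ψ : (Q → Bool) → ℂ) :
    reduce τ (pureState ψ) = cutMatrix τ ψ * (cutMatrix τ ψ)ᴴ := by
  ext a a'
  rw [reduce_apply, Matrix.mul_apply]
  rfl

/-- For a product vector the reduced state is that of `α` times the squared norm of `β`. That norm
is not computed but read off from the trace. -/
theorem reduce_pureState_of_eq_mul [hQ : DecidableEq Q] [DecidableEq T] {τ : T ↪ Q}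
    {ψ : (Q → Bool) → ℂ} {α : (T → Bool) → ℂ} {β : ({q // q ∉ Set.range τ} → Bool) → ℂ}
    (h : ∀ a e, ψ (glue τ a e) = α a * β e) (hα : ∑ a, ‖α a‖ ^ 2 = 1)
    (hψ : ∑ x, ‖ψ x‖ ^ 2 = 1) : reduce τ (pureState ψ) = pureState α := by
  have hred : ∀ a a', reduce τ (pureState ψ) a a' =
      pureState α a a' * ((∑ e, ‖β e‖ ^ 2 : ℝ) : ℂ) := by
    intro a a'
    rw [reduce_apply, Complex.ofReal_sum, Finset.mul_sum]
    refine Finset.sum_congr rfl fun e _ => ?_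
    simp only [pureState, Matrix.of_apply, h, star_mul']
    rw [← Complex.normSq_eq_norm_sq, ← Complex.mul_conj, Complex.star_def]
    ring
  have h1 := trace_reduce τ (pureState ψ)
  have h2 : (reduce τ (pureState ψ)).trace =
      (pureState α).trace * ((∑ e, ‖β e‖ ^ 2 : ℝ) : ℂ) := by
    simp only [Matrix.trace, Matrix.diag_apply, hred, Finset.sum_mul]
  rw [h2, trace_pureState, trace_pureState, hα, hψ, Complex.ofReal_one, one_mul] at h1
  ext a a'
  rw [hred, h1, mul_one]

/-- A state with Schmidt coefficients of equal modulus, all of them occurring on the side `τ`. -/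
theorem reduce_pureState_of_injective [hQ : DecidableEq Q] [DecidableEq T] {τ : T ↪ Q}
    {ψ : (Q → Bool) → ℂ} {e₀ : (T → Bool) → {q // q ∉ Set.range τ} → Bool}
    (he₀ : Function.Injective e₀) {c : ℂ} (h : ∀ a, ψ (glue τ a (e₀ a)) = c)
    (h0 : ∀ a e, e ≠ e₀ a → ψ (glue τ a e) = 0) :
    reduce τ (pureState ψ) = Matrix.diagonal fun _ => ((‖c‖ ^ 2 : ℝ) : ℂ) := by
  ext a a'
  rw [reduce_apply, Finset.sum_eq_single (e₀ a)]
  · simp only [pureState, Matrix.of_apply, h]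
    by_cases haa : a = a'
    · rw [← haa, h, Matrix.diagonal_apply_eq, Complex.star_def, Complex.mul_conj,
        Complex.normSq_eq_norm_sq]
    · rw [h0 a' (e₀ a) fun h' => haa (he₀ h'), Matrix.diagonal_apply_ne _ haa, star_zero, mul_zero]
  · intro e _ he
    simp [pureState, h0 a e he]
  · simp

/-- The spectrum is flat: `2 ^ A.card` eigenvalues, all equal to `‖c‖ ^ 2`. The trace gives the norm
of `ψ` from the same data. -/
theorem entanglementEntropy_of_injective [hQ : DecidableEq Q] {A : Finset Q}
    {ψ : (Q → Bool) → ℂ} {e₀ : ({q // q ∈ A} → Bool) →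
      {q // q ∉ Set.range (Function.Embedding.subtype (· ∈ A))} → Bool}
    (he₀ : Function.Injective e₀) {c : ℂ}
    (h : ∀ a, ψ (glue (Function.Embedding.subtype (· ∈ A)) a (e₀ a)) = c)
    (h0 : ∀ a e, e ≠ e₀ a → ψ (glue (Function.Embedding.subtype (· ∈ A)) a e) = 0) :
    ∑ x, ‖ψ x‖ ^ 2 = 2 ^ A.card * ‖c‖ ^ 2 ∧
      entanglementEntropy A ψ = 2 ^ A.card * Real.negMulLog (‖c‖ ^ 2) / Real.log 2 := by
  obtain rfl : hQ = fun a b => Classical.propDecidable (a = b) := Subsingleton.elim _ _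
  have hred := reduce_pureState_of_injective he₀ h h0
  constructor
  · have htr := trace_reduce (Function.Embedding.subtype (· ∈ A)) (pureState ψ)
    rw [trace_pureState, hred, Matrix.trace_diagonal, Finset.sum_const, Finset.card_univ,
      Fintype.card_fun, Fintype.card_bool, Fintype.card_coe] at htr
    rw [← Complex.ofReal_inj, ← htr]
    simp
  · rw [entanglementEntropy, hred, vonNeumannEntropy_diagonal fun _ => ‖c‖ ^ 2, shannonEntropy,
      Finset.sum_const, Finset.card_univ, Fintype.card_fun, Fintype.card_bool, Fintype.card_coe,
      nsmul_eq_mul, Nat.cast_pow, Nat.cast_ofNat]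

/-- The two sides of a cut of a pure state have the same entropy. -/
theorem entanglementEntropy_eq_complement (A : Finset Q) (ψ : (Q → Bool) → ℂ) :
    entanglementEntropy A ψ = vonNeumannEntropy
      ((cutMatrix (Function.Embedding.subtype (· ∈ A)) ψ)ᴴ *
        cutMatrix (Function.Embedding.subtype (· ∈ A)) ψ) := by
  rw [entanglementEntropy, reduce_pureState]
  exact vonNeumannEntropy_mul_comm _ _ (Matrix.isHermitian_mul_conjTranspose_self _)
    (Matrix.isHermitian_conjTranspose_mul_self _)

end Glue

/-! ## Moving a qubit across a cut -/

section Move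

variable {Q : Type}

/-- The part of an assignment on `A` splits into its value at `q ∈ A` and the part on the others. -/
noncomputable def eraseEquiv {A : Finset Q} {q : Q} (hq : q ∈ A) :
    ({p // p ∈ A.erase q} → Bool) × Bool ≃ ({p // p ∈ A} → Bool) where
  toFun x p := if h : p.1 = q then x.2 else x.1 ⟨p.1, Finset.mem_erase.mpr ⟨h, p.2⟩⟩
  invFun a := (fun p => a ⟨p.1, Finset.mem_of_mem_erase p.2⟩, a ⟨q, hq⟩)
  left_inv x := by
    ext p
    · have := Finset.ne_of_mem_erase p.2
      simp [this]
    · simp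
  right_inv a := by
    funext p
    by_cases h : p.1 = q
    · subst h
      simp
    · simp [h]

/-- An assignment off `A.erase q` splits into its value at `q` and the part off `A`. -/
noncomputable def eraseComplEquiv {A : Finset Q} {q : Q} (hq : q ∈ A) :
    ({p // p ∉ Set.range (Function.Embedding.subtype (· ∈ A))} → Bool) × Bool ≃
      ({p // p ∉ Set.range (Function.Embedding.subtype (· ∈ A.erase q))} → Bool) where
  toFun x p := if h : p.1 = q then x.2 else x.1 ⟨p.1, by
    have := p.2
    simp only [Function.Embedding.coe_subtype, Subtype.range_coe_subtype, Set.mem_ofPred_eq,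
      Finset.mem_erase, not_and] at this ⊢
    exact this h⟩
  invFun e := (fun p => e ⟨p.1, by
    have := p.2
    simp only [Function.Embedding.coe_subtype, Subtype.range_coe_subtype, Set.mem_ofPred_eq,
      Finset.mem_erase, not_and] at this ⊢
    exact fun _ => this⟩, e ⟨q, by simp⟩)
  left_inv x := by
    ext p
    · have h : p.1 ≠ q := by
        rintro h
        apply p.2
        simpa [h] using hq
      simp only [h, dite_false]
    · simp
  right_inv a := by
    funext p
    by_cases h : p.1 = q
    · simp only [h, dite_true]
      congr 1
      exact Subtype.ext h.symm
    · simp only [h, dite_false]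

theorem eraseComplEquiv_apply {A : Finset Q} {q : Q} (hq : q ∈ A)
    (e : {p // p ∉ Set.range (Function.Embedding.subtype (· ∈ A))} → Bool) (b : Bool)
    (p : {p // p ∉ Set.range (Function.Embedding.subtype (· ∈ A.erase q))}) :
    eraseComplEquiv hq (e, b) p = if h : p.1 = q then b else e ⟨p.1, by
      have := p.2
      simp only [Function.Embedding.coe_subtype, Subtype.range_coe_subtype, Set.mem_ofPred_eq,
        Finset.mem_erase, not_and] at this ⊢
      exact this h⟩ := rfl

/-- The value at `q` may be counted with `A` or with its complement without changing the full
assignment. This is what identifies the two amplitude matrices below up to moving one index. -/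
theorem glue_erase {A : Finset Q} {q : Q} (hq : q ∈ A) (a : {p // p ∈ A.erase q} → Bool) (b : Bool)
    (e : {p // p ∉ Set.range (Function.Embedding.subtype (· ∈ A))} → Bool) :
    glue (Function.Embedding.subtype (· ∈ A.erase q)) a (eraseComplEquiv hq (e, b)) =
      glue (Function.Embedding.subtype (· ∈ A)) (eraseEquiv hq (a, b)) e := by
  funext p
  by_cases hA : p ∈ A
  · rw [show glue (Function.Embedding.subtype (· ∈ A)) (eraseEquiv hq (a, b)) e p =
      eraseEquiv hq (a, b) ⟨p, hA⟩ from
        glue_apply (Function.Embedding.subtype (· ∈ A)) _ e ⟨p, hA⟩]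
    by_cases hp : p = q
    · rw [show glue (Function.Embedding.subtype (· ∈ A.erase q)) a (eraseComplEquiv hq (e, b)) p =
        eraseComplEquiv hq (e, b) ⟨p, by simp [hp]⟩ from
          glue_apply_of_notMem _ a _ ⟨p, by simp [hp]⟩]
      rw [eraseComplEquiv_apply, dif_pos hp]
      simp [eraseEquiv, hp]
    · have hm : p ∈ A.erase q := Finset.mem_erase.mpr ⟨hp, hA⟩
      rw [show glue (Function.Embedding.subtype (· ∈ A.erase q)) a (eraseComplEquiv hq (e, b)) p =
        a ⟨p, hm⟩ from glue_apply (Function.Embedding.subtype (· ∈ A.erase q)) a _ ⟨p, hm⟩]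
      simp [eraseEquiv, hp]
  · have h1 : p ∉ Set.range (Function.Embedding.subtype (· ∈ A)) := by simpa using hA
    have h2 : p ∉ Set.range (Function.Embedding.subtype (· ∈ A.erase q)) := by simp [hA]
    have hp : p ≠ q := fun h => hA (h ▸ hq)
    rw [show glue (Function.Embedding.subtype (· ∈ A.erase q)) a (eraseComplEquiv hq (e, b)) p = _
      from glue_apply_of_notMem _ a _ ⟨p, h2⟩,
      show glue (Function.Embedding.subtype (· ∈ A)) (eraseEquiv hq (a, b)) e p = _
      from glue_apply_of_notMem _ _ e ⟨p, h1⟩]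
    rw [eraseComplEquiv_apply, dif_neg hp]

theorem entanglementEntropy_erase_le [Fintype Q] [hQ : DecidableEq Q] {A : Finset Q} {q : Q}
    (hq : q ∈ A) {ψ : (Q → Bool) → ℂ}
    (hψ : ∑ x, ‖ψ x‖ ^ 2 = 1) :
    entanglementEntropy (A.erase q) ψ ≤ entanglementEntropy A ψ + 1 := by
  obtain rfl : hQ = fun a b => Classical.propDecidable (a = b) := Subsingleton.elim _ _
  -- On the complementary sides the moved qubit is an added one, so the state belonging to `A` is
  -- the partial trace over `q` of the state belonging to `A.erase q`.
  rw [entanglementEntropy_eq_complement, entanglementEntropy_eq_complement]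
  set M := cutMatrix (Function.Embedding.subtype (· ∈ A.erase q)) ψ with hM
  set L := cutMatrix (Function.Embedding.subtype (· ∈ A)) ψ with hL
  have hpsd : (Mᴴ * M).PosSemidef := Matrix.posSemidef_conjTranspose_mul_self M
  rw [← vonNeumannEntropy_submatrix_equiv (eraseComplEquiv hq) hpsd.isHermitian]
  have htr : ((Mᴴ * M).submatrix (eraseComplEquiv hq) (eraseComplEquiv hq)).trace = 1 := by
    have h1 : ((Mᴴ * M).submatrix (eraseComplEquiv hq) (eraseComplEquiv hq)).trace =
        (Mᴴ * M).trace := by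
      simp only [Matrix.trace, Matrix.diag_apply, Matrix.submatrix_apply]
      exact (eraseComplEquiv hq).sum_comp fun i => (Mᴴ * M) i i
    rw [h1, Matrix.trace_mul_comm, hM, ← reduce_pureState, trace_reduce, trace_pureState, hψ,
      Complex.ofReal_one]
  refine (vonNeumannEntropy_le_partialTrace_add (hpsd.submatrix _)).trans ?_
  rw [htr, Complex.one_re]
  refine add_le_add_left (le_of_eq ?_) 1
  congr 1
  ext e e'
  simp only [Matrix.of_apply, Matrix.submatrix_apply, Matrix.mul_apply, Matrix.conjTranspose_apply]
  rw [← (eraseEquiv hq).sum_comp, Fintype.sum_prod_type, Finset.sum_comm]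
  simp only [hM, hL, cutMatrix, Matrix.of_apply, glue_erase hq]

end Move

/-! ## Schmidt rank -/

section Schmidt

variable {Q T : Type}

/-- `φ` is a sum of `r` products with respect to the cut of the register into the qubits with `S`
and those without. -/
def HasSchmidtRankLE (S : Q → Prop) (r : ℕ) (φ : (Q → Bool) → ℂ) : Prop :=
  ∃ f g : Fin r → (Q → Bool) → ℂ,
    (∀ i x y, (∀ q, S q → x q = y q) → f i x = f i y) ∧
    (∀ i x y, (∀ q, ¬ S q → x q = y q) → g i x = g i y) ∧
    ∀ x, φ x = ∑ i, f i x * g i x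

theorem HasSchmidtRankLE.of_fintype {S : Q → Prop} {φ : (Q → Bool) → ℂ} {I : Type} [Fintype I]
    {r : ℕ} (hr : Fintype.card I = r) (f g : I → (Q → Bool) → ℂ)
    (hf : ∀ i x y, (∀ q, S q → x q = y q) → f i x = f i y)
    (hg : ∀ i x y, (∀ q, ¬ S q → x q = y q) → g i x = g i y)
    (h : ∀ x, φ x = ∑ i, f i x * g i x) : HasSchmidtRankLE S r φ := by
  subst hr
  let e := (Fintype.equivFin I).symm
  refine ⟨fun i => f (e i), fun i => g (e i), fun i => hf (e i), fun i => hg (e i), fun x => ?_⟩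
  rw [h, ← e.sum_comp]

theorem HasSchmidtRankLE.const_mul {S : Q → Prop} {r : ℕ} {φ : (Q → Bool) → ℂ}
    (h : HasSchmidtRankLE S r φ) (c : ℂ) : HasSchmidtRankLE S r (fun x => c * φ x) := by
  obtain ⟨f, g, hf, hg, h⟩ := h
  refine ⟨fun i x => c * f i x, g, fun i x y hxy => by simp only [hf i x y hxy], hg, fun x => ?_⟩
  simp only [h, Finset.mul_sum, mul_assoc]

theorem hasSchmidtRankLE_zeroVec (S : Q → Prop) : HasSchmidtRankLE S 1 (zeroVec Q) := by
  refine ⟨fun _ x => if ∀ q, S q → x q = false then 1 else 0,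
    fun _ x => if ∀ q, ¬ S q → x q = false then 1 else 0, ?_, ?_, ?_⟩
  · intro _ x y h
    have : (∀ q, S q → x q = false) ↔ (∀ q, S q → y q = false) :=
      forall_congr' fun q => imp_congr_right fun hq => by rw [h q hq]
    simp only [this]
  · intro _ x y h
    have : (∀ q, ¬ S q → x q = false) ↔ (∀ q, ¬ S q → y q = false) :=
      forall_congr' fun q => imp_congr_right fun hq => by rw [h q hq]
    simp only [this]
  · intro x
    have : x = (fun _ => false) ↔ (∀ q, S q → x q = false) ∧ (∀ q, ¬ S q → x q = false) := by
      rw [funext_iff]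
      exact ⟨fun h => ⟨fun q _ => h q, fun q _ => h q⟩, fun h q => by
        by_cases hq : S q
        exacts [h.1 q hq, h.2 q hq]⟩
    simp only [zeroVec, this, ite_and, Finset.univ_unique, Finset.sum_singleton, mul_ite, mul_one,
      mul_zero]
    split_ifs <;> rfl

/-- Sending a qubit across the cut at most doubles the Schmidt rank. -/
theorem HasSchmidtRankLE.move {S S' : Q → Prop} {r : ℕ} {φ : (Q → Bool) → ℂ}
    (h : HasSchmidtRankLE S r φ) (q : Q) (hS : ∀ p, S' p ↔ S p ∧ p ≠ q) :
    HasSchmidtRankLE S' (r * 2) φ := by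
  obtain ⟨f, g, hf, hg, h⟩ := h
  -- Each product is split by the value `b` of qubit `q`: fixing `q` to `b` in `f` removes its
  -- dependence on `q`, and the indicator of `x q = b` joins the other factor.
  refine .of_fintype (I := Fin r × Bool) (by simp)
    (fun i x => f i.1 (Function.update x q i.2)) (fun i x => if x q = i.2 then g i.1 x else 0)
    ?_ ?_ ?_
  · intro i x y hxy
    refine hf _ _ _ fun p hp => ?_
    by_cases hpq : p = q
    · subst hpq; simp
    · simp [hpq, hxy p ((hS p).mpr ⟨hp, hpq⟩)]
  · intro i x y hxy
    have hq : x q = y q := hxy q fun h => ((hS q).mp h).2 rfl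
    simp only [hq, hg i.1 x y fun p hp => hxy p fun h => hp ((hS p).mp h).1]
  · intro x
    rw [h, Fintype.sum_prod_type]
    refine Finset.sum_congr rfl fun i _ => ?_
    rw [Finset.sum_eq_single (x q)]
    · simp
    · intro b _ hb
      simp [hb.symm]
    · simp

/-- `ρ` is a mixture of pure states of Schmidt rank at most `r`. -/
def HasSchmidtNumberLE (S : Q → Prop) (r : ℕ) (ρ : QOp Q) : Prop :=
  ∃ (I : Type) (_ : Fintype I) (φ : I → (Q → Bool) → ℂ),
    (∀ i, HasSchmidtRankLE S r (φ i)) ∧ ρ = ∑ i, pureState (φ i)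

theorem HasSchmidtNumberLE.sum {S : Q → Prop} {r : ℕ} {J : Type} [Fintype J] {ρ : J → QOp Q}
    (h : ∀ j, HasSchmidtNumberLE S r (ρ j)) : HasSchmidtNumberLE S r (∑ j, ρ j) := by
  choose I hI φ hφ hρ using h
  refine ⟨Σ j, I j, inferInstance, fun p => φ p.1 p.2, fun p => hφ _ _, ?_⟩
  rw [Fintype.sum_sigma]
  exact Finset.sum_congr rfl fun j _ => hρ j

/-! ### Schmidt rank under local operations and protocols -/

variable [Fintype Q]

theorem sum_ite_agree_off {V : Type} (o : Q → V) (v : V) (x : Q → Bool) (F : (Q → Bool) → ℂ) :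
    (∑ y, if ∀ q, o q ≠ v → x q = y q then F y else 0) =
      ∑ z : {q // o q = v} → Bool, F fun q => if h : o q = v then z ⟨q, h⟩ else x q := by
  rw [← Finset.sum_filter]
  refine Finset.sum_bij' (fun y _ q => y q) (fun z _ q => if h : o q = v then z ⟨q, h⟩ else x q)
    (by simp) ?_ ?_ ?_ ?_
  · intro z _
    simp +contextual
  · intro y hy
    funext q
    by_cases h : o q = v
    · simp [h]
    · simp [h, (Finset.mem_filter.mp hy).2 q h]
  · intro z _
    funext q
    simp [q.2]
  · intro y hy
    congr 1
    funext q
    by_cases h : o q = v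
    · simp [h]
    · simp [h, (Finset.mem_filter.mp hy).2 q h]

/-- A local operator acts by a sum over the assignments of the local qubits. -/
theorem IsLocalAt.exists_mulVec {V : Type} {o : Q → V} {v : V} {K : QOp Q} (hK : IsLocalAt o v K) :
    ∃ K' : QOp {q : Q // o q = v}, ∀ φ x, (K *ᵥ φ) x = ∑ z, K' (fun q => x q) z *
      φ (fun q => if h : o q = v then z ⟨q, h⟩ else x q) := by
  obtain ⟨K', hK'⟩ := hK
  refine ⟨K', fun φ x => ?_⟩
  simp only [Matrix.mulVec, dotProduct, hK', ite_mul, zero_mul]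
  rw [sum_ite_agree_off o v x fun y => K' (fun q => x q) (fun q => y q) * φ y]
  refine Finset.sum_congr rfl fun z _ => ?_
  congr 2
  funext q
  simp [q.2]

/-- A node lies entirely on one side of the cut, so the operator can be absorbed into the factor of
that side and the number of terms is unchanged. -/
theorem HasSchmidtRankLE.mulVec {V : Type} {o : Q → V} {v : V} {K : QOp Q} (hK : IsLocalAt o v K)
    (isA : V → Prop) {r : ℕ} {φ : (Q → Bool) → ℂ}
    (h : HasSchmidtRankLE (fun q => isA (o q)) r φ) :
    HasSchmidtRankLE (fun q => isA (o q)) r (K *ᵥ φ) := by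
  obtain ⟨K', hK'⟩ := hK.exists_mulVec
  obtain ⟨f, g, hf, hg, h⟩ := h
  by_cases hv : isA v
  · refine ⟨fun i x => ∑ z, K' (fun q => x q) z *
      f i (fun q => if h : o q = v then z ⟨q, h⟩ else x q), g, ?_, hg, ?_⟩
    · intro i x y hxy
      have h1 : (fun q : {q // o q = v} => x q) = fun q : {q // o q = v} => y q := by
        funext q
        exact hxy q (by simpa only [q.2] using hv)
      simp only [h1]
      refine Finset.sum_congr rfl fun z _ => ?_
      congr 1
      refine hf _ _ _ fun q hq => ?_
      rw [hxy q hq]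
    · intro x
      rw [hK']
      simp only [h, Finset.sum_mul, Finset.mul_sum]
      rw [Finset.sum_comm]
      refine Finset.sum_congr rfl fun i _ => Finset.sum_congr rfl fun z _ => ?_
      rw [hg i _ x, mul_assoc]
      intro q hq
      have : o q ≠ v := fun h => hq (by simpa only [h] using hv)
      simp [this]
  · refine ⟨f, fun i x => ∑ z, K' (fun q => x q) z *
      g i (fun q => if h : o q = v then z ⟨q, h⟩ else x q), hf, ?_, ?_⟩
    · intro i x y hxy
      have h1 : (fun q : {q // o q = v} => x q) = fun q : {q // o q = v} => y q := by
        funext q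
        exact hxy q (by simpa only [q.2] using hv)
      simp only [h1]
      refine Finset.sum_congr rfl fun z _ => ?_
      congr 1
      refine hg _ _ _ fun q hq => ?_
      rw [hxy q hq]
    · intro x
      rw [hK']
      simp only [h, Finset.mul_sum]
      rw [Finset.sum_comm]
      refine Finset.sum_congr rfl fun i _ => Finset.sum_congr rfl fun z _ => ?_
      rw [hf i _ x]
      · ring
      intro q hq
      have : o q ≠ v := fun h => hv (by simpa only [h] using hq)
      simp [this]

theorem conj_pureState (K : QOp Q) (φ : (Q → Bool) → ℂ) :
    K * pureState φ * Kᴴ = pureState (K *ᵥ φ) := by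
  have h : ∀ ψ : (Q → Bool) → ℂ, pureState ψ = Matrix.vecMulVec ψ (star ψ) := fun _ => rfl
  rw [h, h, Matrix.mul_vecMulVec, Matrix.vecMulVec_mul, Matrix.star_mulVec]

theorem HasSchmidtNumberLE.conj {V : Type} {o : Q → V} {v : V} {K : QOp Q} (hK : IsLocalAt o v K)
    (isA : V → Prop) {r : ℕ} {ρ : QOp Q} (h : HasSchmidtNumberLE (fun q => isA (o q)) r ρ) :
    HasSchmidtNumberLE (fun q => isA (o q)) r (K * ρ * Kᴴ) := by
  obtain ⟨I, hI, φ, hφ, rfl⟩ := h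
  refine ⟨I, hI, fun i => K *ᵥ φ i, fun i => (hφ i).mulVec hK isA, ?_⟩
  simp only [Finset.mul_sum, Finset.sum_mul, conj_pureState]

/-- Only transmissions across the cut raise the Schmidt number, each by a factor of at most two. -/
theorem Run.hasSchmidtNumberLE {V C : Type} {src tgt : C → V} {cc : Bool} (isA : V → Prop)
    (hC : ∀ c, isA (tgt c) → isA (src c)) {cs : List C} {o o' : Q → V} {ρ σ : QOp Q}
    (h : Run src tgt cc cs o ρ o' σ) : ∀ r, HasSchmidtNumberLE (fun q => isA (o q)) r ρ →
      HasSchmidtNumberLE (fun q => isA (o' q))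
        (r * 2 ^ cs.countP (fun c => isA (src c) ∧ ¬ isA (tgt c))) σ := by
  induction h with
  | done o ρ => intro r hr; simpa using hr
  | localOp v a b K hlocal htrace hcc σ hrest ih =>
    intro r hr
    exact .sum fun k => ih k r (.sum fun l => hr.conj (hlocal k l) isA)
  | send c q hq hrest ih =>
    rename_i cs o o' ρ σ
    rintro r ⟨I, hI, φ, hφ, hρ⟩
    by_cases hA : isA (src c) ∧ ¬ isA (tgt c)
    · rw [List.countP_cons_of_pos (by simpa using hA), pow_succ', ← mul_assoc]
      refine ih _ ⟨I, hI, φ, fun i => (hφ i).move q fun p => ?_, hρ⟩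
      by_cases hp : p = q
      · subst hp; simp [hA.2]
      · simp [hp]
    -- By `hC` no channel enters the `isA` side from outside, so a transmission that is not counted
    -- has both ends on the same side and leaves the cut unchanged.
    · rw [List.countP_cons_of_neg (by simpa using hA)]
      refine ih _ ⟨I, hI, φ, fun i => ?_, hρ⟩
      convert hφ i using 2 with p
      by_cases hp : p = q
      · subst hp
        rw [Function.update_self, hq]
        exact ⟨hC c, fun h => by_contra fun h' => hA ⟨h, h'⟩⟩
      · simp [hp]

/-- Single branches lose trace, but the sum over all announced and discarded outcomes preserves it
by completeness of the Kraus operators. -/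
theorem Run.trace_eq [hQ : DecidableEq Q] {V C : Type} {src tgt : C → V} {cc : Bool}
    {cs : List C} {o o' : Q → V}
    {ρ σ : QOp Q} (h : Run src tgt cc cs o ρ o' σ) : σ.trace = ρ.trace := by
  obtain rfl : hQ = fun a b => Classical.propDecidable (a = b) := Subsingleton.elim _ _
  induction h with
  | done o ρ => rfl
  | localOp v a b K hlocal htrace hcc σ hrest ih =>
    rename_i cs o o' ρ
    rw [Matrix.trace_sum]
    simp only [ih, Matrix.trace_sum]
    calc ∑ k, ∑ l, (K k l * ρ * (K k l)ᴴ).trace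
        = ∑ k, ∑ l, ((K k l)ᴴ * K k l * ρ).trace := by
          refine Finset.sum_congr rfl fun k _ => Finset.sum_congr rfl fun l _ => ?_
          rw [Matrix.trace_mul_comm, Matrix.mul_assoc]
      _ = ((∑ k, ∑ l, (K k l)ᴴ * K k l) * ρ).trace := by
          simp only [Finset.sum_mul, Matrix.trace_sum]
      _ = ρ.trace := by rw [htrace, Matrix.one_mul]
  | send c q hq hrest ih => exact ih

/-- The terms of a decomposition of a pure state are multiples of it. -/
theorem exists_smul_of_sum_pureState {ι I : Type} [Fintype ι] [Fintype I] {ψ : ι → ℂ} (hψ : ψ ≠ 0)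
    {χ : I → ι → ℂ} (h : ∑ i, pureState (χ i) = pureState ψ) :
    ∃ (i : I) (c : ℂ), ∀ x, ψ x = c * χ i x := by
  -- Evaluating both sides as quadratic forms: if `u` is orthogonal to `ψ`, a sum of nonnegative
  -- overlaps vanishes, so `u` is orthogonal to every term.
  have hquad : ∀ u : ι → ℂ, ∑ i, ‖∑ x, star (u x) * χ i x‖ ^ 2 = ‖∑ x, star (u x) * ψ x‖ ^ 2 := by
    intro u
    have hq : ∀ φ : ι → ℂ, ∑ x, ∑ y, star (u x) * pureState φ x y * u y =
        ((‖∑ x, star (u x) * φ x‖ ^ 2 : ℝ) : ℂ) := by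
      intro φ
      rw [← Complex.normSq_eq_norm_sq, Complex.normSq_eq_conj_mul_self, mul_comm, map_sum,
        Finset.sum_mul_sum]
      refine Finset.sum_congr rfl fun x _ => Finset.sum_congr rfl fun y _ => ?_
      simp [pureState]
      ring
    have : (∑ x, ∑ y, star (u x) * (∑ i, pureState (χ i)) x y * u y) =
        ∑ i, ∑ x, ∑ y, star (u x) * pureState (χ i) x y * u y := by
      rw [Finset.sum_comm]
      simp only [Matrix.sum_apply, Finset.mul_sum, Finset.sum_mul]
      conv_rhs => rw [Finset.sum_comm]
      rw [Finset.sum_comm]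
      refine Finset.sum_congr rfl fun x _ => ?_
      rw [Finset.sum_comm]
    rw [h] at this
    simp only [hq] at this
    exact_mod_cast this.symm
  set n : ℂ := ∑ x, star (ψ x) * ψ x with hn
  have hn' : n = ((∑ x, ‖ψ x‖ ^ 2 : ℝ) : ℂ) := by
    simp [hn, mul_comm, Complex.mul_conj, Complex.normSq_eq_norm_sq]
  have hn0 : n ≠ 0 := by
    rw [hn', Complex.ofReal_ne_zero]
    obtain ⟨x, hx⟩ := Function.ne_iff.mp hψ
    refine (Finset.sum_pos' (fun _ _ => by positivity) ⟨x, Finset.mem_univ _, ?_⟩).ne'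
    have : 0 < ‖ψ x‖ := norm_pos_iff.mpr hx
    positivity
  have hstar : star n = n := by rw [hn']; exact Complex.conj_ofReal _
  -- each term is orthogonal to the orthogonal complement of `ψ`
  have horth : ∀ i x, n * χ i x = (∑ y, star (ψ y) * χ i y) * ψ x := by
    intro i
    set s := ∑ y, star (ψ y) * χ i y with hs
    -- Up to the factor `n`, this is the component of `χ i` orthogonal to `ψ`; it turns out to be
    -- orthogonal to itself.
    set u : ι → ℂ := fun x => n * χ i x - s * ψ x with hu
    have h0 : ∑ x, star (u x) * ψ x = 0 := by
      have h1 : star s = ∑ y, star (χ i y) * ψ y := by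
        rw [hs, star_sum]
        refine Finset.sum_congr rfl fun y _ => ?_
        rw [star_mul', star_star, mul_comm]
      simp only [hu, star_sub, star_mul', sub_mul, Finset.sum_sub_distrib, mul_assoc,
        ← Finset.mul_sum, hstar, ← h1, ← hn]
      ring
    have h1 := hquad u
    rw [h0, norm_zero, zero_pow two_ne_zero] at h1
    have h2 := (Finset.sum_eq_zero_iff_of_nonneg fun _ _ => by positivity).mp h1 i
      (Finset.mem_univ _)
    have h3 : ∑ x, star (u x) * χ i x = 0 := by simpa using h2
    have h4 : ∑ x, star (u x) * u x = 0 := by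
      have : ∀ x, star (u x) * u x = n * (star (u x) * χ i x) - s * (star (u x) * ψ x) := by
        intro x
        simp only [hu]
        ring
      simp only [this, Finset.sum_sub_distrib, ← Finset.mul_sum, h0, h3]
      ring
    have h5 : ∑ x, ‖u x‖ ^ 2 = 0 := by
      have : ((∑ x, ‖u x‖ ^ 2 : ℝ) : ℂ) = 0 := by
        rw [← h4]
        simp [mul_comm, Complex.mul_conj, Complex.normSq_eq_norm_sq]
      exact_mod_cast this
    intro x
    have h6 := (Finset.sum_eq_zero_iff_of_nonneg fun _ _ => by positivity).mp h5 x
      (Finset.mem_univ _)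
    have h7 : u x = 0 := by simpa using h6
    exact sub_eq_zero.mp h7
  -- Testing with `ψ` itself gives a nonzero value, so at least one term has nonzero overlap and can
  -- be rescaled to `ψ`.
  have hex : ∃ i, (∑ y, star (ψ y) * χ i y) ≠ 0 := by
    by_contra hall
    push Not at hall
    have := hquad ψ
    simp only [hall, norm_zero] at this
    simp only [ne_eq, OfNat.ofNat_ne_zero, not_false_eq_true, zero_pow, Finset.sum_const_zero]
      at this
    rw [← hn] at this
    exact hn0 (by simpa using this.symm)
  obtain ⟨i, hi⟩ := hex
  refine ⟨i, (∑ y, star (ψ y) * χ i y)⁻¹ * n, fun x => ?_⟩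
  rw [mul_assoc, horth i x, ← mul_assoc, inv_mul_cancel₀ hi, one_mul]

/-! ### Bounds for pure states that can be distributed -/

variable [Fintype T]

/-- The partial trace is again a sum of pure states, one for each term of the mixture and each
assignment of the discarded qubits. One of them is proportional to `ψ`, and fixing the discarded
qubits keeps each product a product. -/
theorem HasSchmidtRankLE.of_reduce {S : Q → Prop} {r : ℕ} {σ : QOp Q}
    (h : HasSchmidtNumberLE S r σ) (τ : T ↪ Q) {ψ : (T → Bool) → ℂ} (hψ : ψ ≠ 0)
    (hred : reduce τ σ = pureState ψ) : HasSchmidtRankLE (fun t => S (τ t)) r ψ := by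
  obtain ⟨I, hI, φ, hφ, rfl⟩ := h
  have hsum : ∑ p : I × ({q // q ∉ Set.range τ} → Bool),
      pureState (fun a => φ p.1 (glue τ a p.2)) = pureState ψ := by
    rw [← hred]
    ext a a'
    rw [reduce_apply, Fintype.sum_prod_type, Matrix.sum_apply]
    simp only [Matrix.sum_apply]
    rw [Finset.sum_comm]
    rfl
  obtain ⟨p, c, hc⟩ := exists_smul_of_sum_pureState hψ hsum
  rw [show ψ = fun a => c * φ p.1 (glue τ a p.2) from funext hc]
  refine HasSchmidtRankLE.const_mul ?_ c
  obtain ⟨f, g, hf, hg, h⟩ := hφ p.1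
  refine ⟨fun i a => f i (glue τ a p.2), fun i a => g i (glue τ a p.2), ?_, ?_, fun a => h _⟩
  · intro i x y hxy
    refine hf i _ _ fun q hq => ?_
    by_cases hr : q ∈ Set.range τ
    · obtain ⟨t, rfl⟩ := hr
      simpa using hxy t hq
    · exact (glue_apply_of_notMem τ x p.2 ⟨q, hr⟩).trans
        (glue_apply_of_notMem τ y p.2 ⟨q, hr⟩).symm
  · intro i x y hxy
    refine hg i _ _ fun q hq => ?_
    by_cases hr : q ∈ Set.range τ
    · obtain ⟨t, rfl⟩ := hr
      simpa using hxy t hq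
    · exact (glue_apply_of_notMem τ x p.2 ⟨q, hr⟩).trans
        (glue_apply_of_notMem τ y p.2 ⟨q, hr⟩).symm

theorem trace_pureState_zeroVec [DecidableEq Q] : (pureState (zeroVec Q)).trace = 1 := by
  rw [trace_pureState, Finset.sum_eq_single fun _ => false]
  · simp [zeroVec]
  · intro x _ hx
    simp [zeroVec, hx]
  · simp

/-- A pure state that can be distributed has norm one, and its Schmidt rank across a cut is bounded
by the number of transmissions across the cut. -/
theorem Distributes.schmidt [DecidableEq T] {V C : Type} {src tgt : C → V} {cc : Bool}
    {cs : List C} {loc : T → V}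
    {ψ : (T → Bool) → ℂ} (h : Distributes src tgt cc cs loc (pureState ψ)) (isA : V → Prop)
    (hC : ∀ c, isA (tgt c) → isA (src c)) :
    ∑ x, ‖ψ x‖ ^ 2 = 1 ∧ HasSchmidtRankLE (fun t => isA (loc t))
      (2 ^ cs.countP (fun c => isA (src c) ∧ ¬ isA (tgt c))) ψ := by
  obtain ⟨n, o, o', σ, τ, hrun, hloc, hred⟩ := h
  have htr : ∑ x, ‖ψ x‖ ^ 2 = 1 := by
    have h1 := trace_reduce τ σ
    rw [hred, hrun.trace_eq, trace_pureState_zeroVec, trace_pureState] at h1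
    exact_mod_cast h1
  have hψ : ψ ≠ 0 := by
    rintro rfl
    simp at htr
  refine ⟨htr, ?_⟩
  have h2 := hrun.hasSchmidtNumberLE isA hC 1
    ⟨Unit, inferInstance, fun _ => zeroVec _, fun _ => hasSchmidtRankLE_zeroVec _, by simp⟩
  rw [one_mul] at h2
  have h3 := HasSchmidtRankLE.of_reduce h2 τ hψ hred
  simpa only [hloc] using h3

/-- A sum of `r` products factors the amplitude matrix through `Fin r`, which bounds the rank of the
reduced state by `r`. -/
theorem entanglementEntropy_le_logb [hQ : DecidableEq Q] {A : Finset Q} {S : Q → Prop}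
    (hS : ∀ q, q ∈ A ↔ S q) {r : ℕ}
    {ψ : (Q → Bool) → ℂ} (hψ : ∑ x, ‖ψ x‖ ^ 2 = 1) (h : HasSchmidtRankLE S r ψ) :
    entanglementEntropy A ψ ≤ Real.logb 2 r := by
  obtain rfl : hQ = fun a b => Classical.propDecidable (a = b) := Subsingleton.elim _ _
  obtain rfl : S = (· ∈ A) := funext fun q => propext (hS q).symm
  obtain ⟨f, g, hf, hg, h⟩ := h
  rw [entanglementEntropy]
  set τ := Function.Embedding.subtype (· ∈ A) with hτ
  have hred := reduce_pureState τ ψ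
  refine vonNeumannEntropy_le_logb_rank ?_ ?_ ?_
  · rw [hred]
    exact Matrix.posSemidef_self_mul_conjTranspose _
  · rw [trace_reduce, trace_pureState, hψ, Complex.ofReal_one]
  · let F : Matrix ({q // q ∈ A} → Bool) (Fin r) ℂ :=
      Matrix.of fun a i => f i (glue τ a fun _ => false)
    let G : Matrix (Fin r) ({q // q ∉ Set.range τ} → Bool) ℂ :=
      Matrix.of fun i e => g i (glue τ (fun _ => false) e)
    have hFG : cutMatrix τ ψ = F * G := by
      ext a e
      rw [Matrix.mul_apply]
      refine (h _).trans (Finset.sum_congr rfl fun i _ => ?_)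
      congr 1
      · refine hf i _ _ fun q hq => ?_
        exact (glue_apply τ a e ⟨q, hq⟩).trans (glue_apply τ a _ ⟨q, hq⟩).symm
      · refine hg i _ _ fun q hq => ?_
        have hq' : q ∉ Set.range τ := by simpa [hτ] using hq
        exact (glue_apply_of_notMem τ a e ⟨q, hq'⟩).trans
          (glue_apply_of_notMem τ _ e ⟨q, hq'⟩).symm
    rw [hred, hFG, Matrix.mul_assoc]
    exact (Matrix.rank_mul_le_left _ _).trans
      ((Matrix.rank_le_card_width F).trans_eq (Fintype.card_fin r))

theorem Distributes.entanglementEntropy_le {V C : Type} {src tgt : C → V} {cc : Bool} {cs : List C}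
    {loc : T → V} {ψ : (T → Bool) → ℂ} (h : Distributes src tgt cc cs loc (pureState ψ))
    (isA : V → Prop) (hC : ∀ c, isA (tgt c) → isA (src c)) {A : Finset T}
    (hA : ∀ t, t ∈ A ↔ isA (loc t)) :
    entanglementEntropy A ψ ≤ cs.countP (fun c => isA (src c) ∧ ¬ isA (tgt c)) := by
  obtain ⟨h1, h2⟩ := h.schmidt isA hC
  refine (entanglementEntropy_le_logb hA h1 h2).trans_eq ?_
  rw [Nat.cast_pow, Nat.cast_ofNat, Real.logb_pow, Real.logb_self_eq_one (by norm_num), mul_one]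

end Schmidt

/-! ## Constructing protocols -/

section Protocols

variable {V C Q Q' : Type}

theorem IsLocalAt.reindex {o : Q → V} {v : V} {K : QOp Q} (hK : IsLocalAt o v K) (e : Q' ≃ Q) :
    IsLocalAt (o ∘ e) v (K.submatrix (fun x => x ∘ e.symm) (fun x => x ∘ e.symm)) := by
  obtain ⟨K', hK'⟩ := hK
  refine ⟨K'.submatrix (fun x q => x ⟨e.symm q.1, by simpa using q.2⟩)
    (fun x q => x ⟨e.symm q.1, by simpa using q.2⟩), fun x y => ?_⟩
  rw [Matrix.submatrix_apply, hK']
  have h : (∀ q, o q ≠ v → (x ∘ e.symm) q = (y ∘ e.symm) q) ↔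
      (∀ q, (o ∘ e) q ≠ v → x q = y q) := by
    rw [← e.forall_congr_right]
    simp
  simp only [h]
  rfl

variable [Fintype Q] [Fintype Q']

/-- `Distributes` asks for a register labelled by `Fin n`, whereas explicit protocols are more
natural on structured labels. -/
theorem Run.reindex {src tgt : C → V} {cc : Bool} {cs : List C} {o o' : Q → V} {ρ σ : QOp Q}
    (h : Run src tgt cc cs o ρ o' σ) (e : Q' ≃ Q) :
    Run src tgt cc cs (o ∘ e) (ρ.submatrix (fun x => x ∘ e.symm) (fun x => x ∘ e.symm)) (o' ∘ e)
      (σ.submatrix (fun x => x ∘ e.symm) (fun x => x ∘ e.symm)) := by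
  let E : (Q' → Bool) ≃ (Q → Bool) := Equiv.arrowCongr e (Equiv.refl Bool)
  have hE : (fun x : Q' → Bool => x ∘ e.symm) = E := rfl
  rw [hE]
  induction h with
  | done o ρ => exact .done _ _
  | localOp v a b K hlocal htrace hcc σ hrest ih =>
    rw [show (∑ k, σ k).submatrix E E = ∑ k, (σ k).submatrix E E by
      ext; simp [Matrix.sum_apply]]
    refine .localOp v a b (fun k l => (K k l).submatrix E E) (fun k l => (hlocal k l).reindex e)
      ?_ hcc _ fun k => ?_
    · rw [← Matrix.submatrix_one_equiv E, ← htrace]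
      simp only [Matrix.conjTranspose_submatrix, Matrix.submatrix_mul_equiv]
      ext; simp [Matrix.sum_apply]
    · convert ih k using 1
      simp only [Matrix.conjTranspose_submatrix, Matrix.submatrix_mul_equiv]
      ext; simp [Matrix.sum_apply]
  | send c q hq hrest ih =>
    refine .send c (e.symm q) (by simpa using hq) ?_
    rw [Function.update_comp_equiv] at ih
    exact ih

theorem reduce_apply_of_surjective (τ : Q' ↪ Q) (hτ : Function.Surjective τ) (ρ : QOp Q)
    (x x' : Q → Bool) : reduce τ ρ (x ∘ τ) (x' ∘ τ) = ρ x x' := by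
  rw [reduce_apply]
  have hempty : IsEmpty {q // q ∉ Set.range τ} := ⟨fun q => q.2 (hτ q.1)⟩
  refine (Fintype.sum_subsingleton _ (fun q => x q.1 : {q // q ∉ Set.range τ} → Bool)).trans ?_
  have h : ∀ (y : Q → Bool), glue τ (y ∘ τ) (fun q => x q.1) = y := by
    intro y
    funext q
    obtain ⟨t, rfl⟩ := hτ q
    exact glue_apply τ _ _ t
  rw [h, h]

/-- A protocol on any finite register shows that the final state can be distributed. -/
theorem Run.distributes {src tgt : C → V} {cc : Bool} {cs : List C} {o o' : Q → V} {σ : QOp Q}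
    (h : Run src tgt cc cs o (pureState (zeroVec Q)) o' σ) :
    Distributes src tgt cc cs o' σ := by
  obtain ⟨e⟩ : Nonempty (Fin (Fintype.card Q) ≃ Q) := ⟨(Fintype.equivFin Q).symm⟩
  refine ⟨Fintype.card Q, o ∘ e, o' ∘ e, σ.submatrix (fun x => x ∘ e.symm) (fun x => x ∘ e.symm),
    e.symm.toEmbedding, ?_, fun t => by simp, ?_⟩
  · convert h.reindex e using 1
    ext x y
    have h0 : ∀ x : Fin (Fintype.card Q) → Bool, (x = fun _ => false) ↔
        (x ∘ e.symm = fun _ => false) := by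
      intro x
      simp only [funext_iff, Function.comp_apply]
      exact (e.symm.forall_congr_right (q := fun i => x i = false)).symm
    simp only [pureState, zeroVec, Matrix.of_apply, Matrix.submatrix_apply, h0]
    congr
  · ext a a'
    have h1 := reduce_apply_of_surjective e.symm.toEmbedding e.symm.surjective
      (σ.submatrix (fun x => x ∘ e.symm) (fun x => x ∘ e.symm)) (a ∘ e) (a' ∘ e)
    have h2 : ∀ a : Q → Bool, (a ∘ e) ∘ e.symm = a := fun a => by funext q; simp
    rw [Matrix.submatrix_apply, h2, h2] at h1
    rw [← h1]
    congr 1 <;> exact (h2 _).symm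

/-- A node may prepare its qubits in any pure state. -/
theorem Run.prepare [hQ : DecidableEq Q] {src tgt : C → V} {cc : Bool} {cs : List C}
    {o o' : Q → V} {σ : QOp Q} (v : V)
    (φ : ({q // o q = v} → Bool) → ℂ) (hφ : ∑ z, ‖φ z‖ ^ 2 = 1)
    (h : Run src tgt cc cs o
      (pureState fun x => if ∀ q, o q ≠ v → x q = false then φ fun q => x q else 0) o' σ) :
    Run src tgt cc cs o (pureState (zeroVec Q)) o' σ := by
  obtain rfl : hQ = fun a b => Classical.propDecidable (a = b) := Subsingleton.elim _ _
  obtain ⟨e⟩ : Nonempty (Fin (Fintype.card ({q // o q = v} → Bool)) ≃ ({q // o q = v} → Bool)) :=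
    ⟨(Fintype.equivFin _).symm⟩
  -- The Kraus operators `|φ⟩⟨l|`, with `l` over the basis of the node: its qubits are discarded and
  -- replaced by `φ`. There is one announced outcome only, so no classical communication is used.
  let K : Fin 1 → Fin (Fintype.card ({q // o q = v} → Bool)) → QOp Q := fun _ l =>
    Matrix.of fun x y => if ∀ q, o q ≠ v → x q = y q then
      φ (fun q => x q) * (if (fun q : {q // o q = v} => y q) = e l then 1 else 0) else 0
  have hsum : σ = ∑ _k : Fin 1, σ := by simp
  rw [hsum]
  refine .localOp v 1 _ K (fun k l => ⟨Matrix.of fun z z' => φ z * if z' = e l then 1 else 0,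
    fun x y => by simp only [K, Matrix.of_apply]; congr⟩) ?_ (Or.inr rfl) (fun _ => σ) fun k => ?_
  · rw [Fintype.sum_unique]
    ext y y'
    rw [Matrix.sum_apply]
    simp only [Matrix.mul_apply, Matrix.conjTranspose_apply, K, Matrix.of_apply]
    rw [Equiv.sum_comp e fun l => ∑ x : Q → Bool, star (if ∀ q, o q ≠ v → x q = y q then
      φ (fun q => x q) * (if (fun q : {q // o q = v} => y q) = l then 1 else 0) else 0) *
      (if ∀ q, o q ≠ v → x q = y' q then
        φ (fun q => x q) * (if (fun q : {q // o q = v} => y' q) = l then 1 else 0) else 0)]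
    rw [Finset.sum_eq_single (fun q : {q // o q = v} => y q)]
    · by_cases hy : y = y'
      · subst hy
        rw [Matrix.one_apply_eq]
        have h1 : ∀ x : Q → Bool, (∀ q, o q ≠ v → x q = y q) ↔ (∀ q, o q ≠ v → y q = x q) :=
          fun x => forall_congr' fun q => imp_congr_right fun _ => eq_comm
        calc _ = ∑ x : Q → Bool, if ∀ q, o q ≠ v → y q = x q then
              star (φ fun q => x q) * φ (fun q => x q) else 0 := by
              refine Finset.sum_congr rfl fun x _ => ?_
              simp only [h1]
              split_ifs <;> simp
          _ = ∑ z, star (φ z) * φ z := by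
              rw [sum_ite_agree_off o v y fun x => star (φ fun q => x q) * φ (fun q => x q)]
              refine Finset.sum_congr rfl fun z _ => ?_
              have : (fun q : {q // o q = v} =>
                  if h : o q.1 = v then z ⟨q.1, h⟩ else y q.1) = z := by
                funext q
                simp [q.2]
              rw [this]
          _ = ((∑ z, ‖φ z‖ ^ 2 : ℝ) : ℂ) := by
              simp [mul_comm, Complex.mul_conj, Complex.normSq_eq_norm_sq]
          _ = 1 := by rw [hφ, Complex.ofReal_one]
      · rw [Matrix.one_apply_ne hy]
        refine Finset.sum_eq_zero fun x _ => ?_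
        by_cases h1 : ∀ q, o q ≠ v → x q = y q
        · by_cases h2 : ∀ q, o q ≠ v → x q = y' q
          · have h3 : (fun q : {q // o q = v} => y' q) ≠ fun q : {q // o q = v} => y q := by
              intro h3
              apply hy
              funext q
              by_cases hq : o q = v
              · exact (congrFun h3 ⟨q, hq⟩).symm
              · rw [← h1 q hq, h2 q hq]
            simp [h3]
          · simp [h2]
        · simp [h1]
    · intro l _ hl
      refine Finset.sum_eq_zero fun x _ => ?_
      simp [hl.symm]
    · simp
  · convert h using 1
    simp only [conj_pureState]
    have hK : ∀ l, K k l *ᵥ zeroVec Q = if (fun _ => false) = e l then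
        (fun x => if ∀ q, o q ≠ v → x q = false then φ fun q => x q else 0) else fun _ => 0 := by
      intro l
      funext x
      simp only [Matrix.mulVec, dotProduct, zeroVec, mul_ite, mul_one, mul_zero,
        Finset.sum_ite_eq', Finset.mem_univ, if_true, K, Matrix.of_apply]
      by_cases h1 : (fun _ => false) = e l
      · simp [h1]
      · simp [h1]
    simp only [hK]
    rw [Finset.sum_eq_single (e.symm fun _ => false)]
    · simp
    · intro l _ hl
      have : (fun _ => false) ≠ e l := fun h => hl (by rw [h]; simp)
      rw [if_neg this]
      ext; simp [pureState]
    · simp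

/-- A node may apply a permutation of the computational basis of its qubits. -/
theorem Run.permute {src tgt : C → V} {cc : Bool} {cs : List C} {o o' : Q → V} {σ : QOp Q} (v : V)
    (F : Equiv.Perm (Q → Bool)) (F' : ({q // o q = v} → Bool) → {q // o q = v} → Bool)
    (hF : ∀ x q, F x q = if h : o q = v then F' (fun q => x q) ⟨q, h⟩ else x q)
    {φ : (Q → Bool) → ℂ} (h : Run src tgt cc cs o (pureState fun x => φ (F x)) o' σ) :
    Run src tgt cc cs o (pureState φ) o' σ := by
  have hsum : σ = ∑ _k : Fin 1, σ := by simp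
  rw [hsum]
  refine .localOp v 1 1 (fun _ _ => Matrix.of fun x y => if F x = y then 1 else 0)
    (fun _ _ => ⟨Matrix.of fun z z' => if F' z = z' then 1 else 0, fun x y => ?_⟩) ?_
    (Or.inr rfl) (fun _ => σ) fun k => ?_
  · have : F x = y ↔ (∀ q, o q ≠ v → x q = y q) ∧
      F' (fun q => x q) = fun q : {q // o q = v} => y q := by
      constructor
      · rintro rfl
        refine ⟨fun q hq => by simp [hF, hq], ?_⟩
        funext q
        simp [hF, q.2]
      · rintro ⟨h1, h2⟩
        funext q
        rw [hF]
        split_ifs with hq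
        · exact congrFun h2 ⟨q, hq⟩
        · exact h1 q hq
    simp only [Matrix.of_apply, this, ite_and]
    congr
  · ext y y'
    rw [Fintype.sum_unique, Fintype.sum_unique]
    simp only [Matrix.mul_apply, Matrix.conjTranspose_apply, Matrix.of_apply, Matrix.one_apply]
    rw [Equiv.sum_comp F fun x => star (if x = y then (1 : ℂ) else 0) * if x = y' then 1 else 0]
    simp [apply_ite (star : ℂ → ℂ), eq_comm]
  · convert h using 1
    rw [Fintype.sum_unique, conj_pureState]
    congr 1
    funext x
    simp [Matrix.mulVec, dotProduct]

end Protocols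

/-! ## GHZ states -/

/-- The GHZ state of the qubits labelled by `T`. -/
noncomputable def ghzVec (T : Type) : (T → Bool) → ℂ :=
  fun x => if (∀ t, x t = false) ∨ (∀ t, x t = true) then (1 / (Real.sqrt 2 : ℂ)) else 0

theorem ghz_eq_ghzVec (m : ℕ) : ghz m = ghzVec (PartyQubit m) := by
  funext x
  simp only [ghz, ghzVec]
  congr

theorem norm_one_div_sqrt_two_sq : ‖(1 / (Real.sqrt 2 : ℂ))‖ ^ 2 = 1 / 2 := by
  rw [norm_div, norm_one, Complex.norm_real, Real.norm_of_nonneg (Real.sqrt_nonneg _), div_pow,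
    Real.sq_sqrt (by norm_num), one_pow]

theorem sum_norm_sq_ghzVec (T : Type) [Fintype T] [DecidableEq T] [Nonempty T] :
    ∑ x, ‖ghzVec T x‖ ^ 2 = 1 := by
  obtain ⟨t⟩ := ‹Nonempty T›
  have hne : (fun _ : T => false) ≠ fun _ => true := fun h => by simpa using congrFun h t
  rw [Finset.sum_eq_add (fun _ => false) (fun _ => true) hne]
  · have h1 : ghzVec T (fun _ => false) = 1 / (Real.sqrt 2 : ℂ) := if_pos (Or.inl fun _ => rfl)
    have h2 : ghzVec T (fun _ => true) = 1 / (Real.sqrt 2 : ℂ) := if_pos (Or.inr fun _ => rfl)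
    rw [h1, h2, norm_one_div_sqrt_two_sq]
    norm_num
  · rintro x - ⟨h1, h2⟩
    have : ghzVec T x = 0 := if_neg (by
      rintro (h | h)
      · exact h1 (funext h)
      · exact h2 (funext h))
    simp [this]
  · simp
  · simp

/-- The router distributes the qubits sent to it, or created by it, to the Bobs. -/
theorem Run.distribute_some {m : ℕ} {Q : Type} [Fintype Q] {cc : Bool}
    (κ : Fin m ↪ Q) (ρ : QOp Q)
    (l : List (Fin m)) (hl : l.Nodup) : ∀ o : Q → Node m, (∀ i ∈ l, o (κ i) = Node.router) →
    ∃ o' : Q → Node m, (∀ i ∈ l, o' (κ i) = Node.bob i) ∧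
      (∀ q, (∀ i ∈ l, q ≠ κ i) → o' q = o q) ∧
      Run (chanSrc m) (chanTgt m) cc (l.map some) o ρ o' ρ := by
  induction l with
  | nil => exact fun o _ => ⟨o, by simp, by simp, .done _ _⟩
  | cons i l ih =>
    intro o ho
    obtain ⟨hi, hl'⟩ := List.nodup_cons.mp hl
    have hne : ∀ j ∈ l, κ j ≠ κ i := fun j hj h => hi (κ.injective h ▸ hj)
    obtain ⟨o', h1, h2, h3⟩ := ih hl' (Function.update o (κ i) (Node.bob i)) fun j hj => by
      rw [Function.update_of_ne (hne j hj)]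
      exact ho j (List.mem_cons_of_mem _ hj)
    refine ⟨o', ?_, ?_, .send (some i) (κ i) (ho i List.mem_cons_self) h3⟩
    · intro j hj
      rcases List.mem_cons.mp hj with rfl | hj
      · rw [h2 _ fun k hk => (hne k hk).symm, Function.update_self]
      · exact h1 j hj
    · intro q hq
      rw [h2 q fun k hk => hq k (List.mem_cons_of_mem _ hk),
        Function.update_of_ne (hq i List.mem_cons_self)]

theorem sum_norm_sq_ghz (m : ℕ) : ∑ x, ‖ghz m x‖ ^ 2 = 1 := by
  rw [ghz_eq_ghzVec]
  exact sum_norm_sq_ghzVec _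

/-- Alice sends qubits to the Bobs, one after the other. -/
theorem Run.distribute_none_some {m : ℕ} {Q : Type} [Fintype Q] {cc : Bool}
    (κ : Fin m ↪ Q) (ρ : QOp Q)
    (l : List (Fin m)) (hl : l.Nodup) : ∀ o : Q → Node m, (∀ i ∈ l, o (κ i) = Node.alice) →
    ∃ o' : Q → Node m, (∀ i ∈ l, o' (κ i) = Node.bob i) ∧
      (∀ q, (∀ i ∈ l, q ≠ κ i) → o' q = o q) ∧
      Run (chanSrc m) (chanTgt m) cc (l.map fun j => [none, some j]).flatten o ρ o' ρ := by
  induction l with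
  | nil => exact fun o _ => ⟨o, by simp, by simp, .done _ _⟩
  | cons i l ih =>
    intro o ho
    obtain ⟨hi, hl'⟩ := List.nodup_cons.mp hl
    have hne : ∀ j ∈ l, κ j ≠ κ i := fun j hj h => hi (κ.injective h ▸ hj)
    obtain ⟨o', h1, h2, h3⟩ := ih hl' (Function.update (Function.update o (κ i) Node.router) (κ i)
      (Node.bob i)) fun j hj => by
      rw [Function.update_of_ne (hne j hj), Function.update_of_ne (hne j hj)]
      exact ho j (List.mem_cons_of_mem _ hj)
    refine ⟨o', ?_, ?_, .send none (κ i) (ho i List.mem_cons_self)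
      (.send (some i) (κ i) (Function.update_self ..) h3)⟩
    · intro j hj
      rcases List.mem_cons.mp hj with rfl | hj
      · rw [h2 _ fun k hk => (hne k hk).symm, Function.update_self]
      · exact h1 j hj
    · intro q hq
      rw [h2 q fun k hk => hq k (List.mem_cons_of_mem _ hk),
        Function.update_of_ne (hq i List.mem_cons_self),
        Function.update_of_ne (hq i List.mem_cons_self)]

/-- The controlled negation of all Bobs' qubits but the `i₀`-th, controlled by that one. -/
noncomputable def fanOut {m : ℕ} (i₀ : Fin m) (x : PartyQubit m → Bool) : PartyQubit m → Bool :=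
  fun t => if t = none ∨ t = some i₀ then x t else xor (x t) (x (some i₀))

theorem fanOut_involutive {m : ℕ} (i₀ : Fin m) : Function.Involutive (fanOut i₀) := by
  intro x
  funext t
  by_cases h : t = none ∨ t = some i₀
  · simp [fanOut, h]
  · simp [fanOut, h]

/-- Alice holds two qubits before the transmission, the router all others. -/
noncomputable def fanOutLoc {m : ℕ} (i₀ : Fin m) (t : PartyQubit m) : Node m :=
  if t = none ∨ t = some i₀ then Node.alice else Node.router

theorem fanOutLoc_eq_alice {m : ℕ} (i₀ : Fin m) (t : PartyQubit m) :
    fanOutLoc i₀ t = Node.alice ↔ t = none ∨ t = some i₀ := by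
  by_cases h : t = none ∨ t = some i₀
  · simp [fanOutLoc, h]
  · simp only [fanOutLoc, h, if_false, reduceCtorEq]

theorem update_fanOutLoc_eq_router {m : ℕ} [DecidableEq (PartyQubit m)] (i₀ : Fin m)
    (t : PartyQubit m) : Function.update (fanOutLoc i₀) (some i₀) Node.router t = Node.router ↔ t ≠ none := by
  by_cases h : t = some i₀
  · simp [h]
  · by_cases h' : t = none
    · simp [fanOutLoc, h']
    · simp [fanOutLoc, h', h]

/-- The input is a Bell pair held by Alice with all other qubits zero. The controlled negations are
an involution of the basis, so they act on amplitudes by precomposition, and `x` becomes constant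
exactly when its image is constant on the pair and zero elsewhere. -/
theorem fanOut_ghzVec {m : ℕ} (i₀ : Fin m) (x : PartyQubit m → Bool) :
    (if ∀ t, fanOutLoc i₀ t ≠ Node.alice → fanOut i₀ x t = false then
      ghzVec {t // fanOutLoc i₀ t = Node.alice} (fun t => fanOut i₀ x t) else 0) = ghz m x := by
  rw [ghz_eq_ghzVec]
  have hGn : ∀ t, (t = none ∨ t = some i₀) → fanOut i₀ x t = x t := fun t h => if_pos h
  have hGs : ∀ t, ¬(t = none ∨ t = some i₀) → fanOut i₀ x t = xor (x t) (x (some i₀)) :=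
    fun t h => if_neg h
  have hb : ∀ b : Bool, (∀ t, fanOutLoc i₀ t ≠ Node.alice → fanOut i₀ x t = false) ∧
      (∀ t : {t // fanOutLoc i₀ t = Node.alice}, fanOut i₀ x t = b) ↔ ∀ t, x t = b := by
    intro b
    constructor
    · rintro ⟨h1, h2⟩ t
      have h0 : x (some i₀) = b := by
        rw [← h2 ⟨some i₀, (fanOutLoc_eq_alice i₀ _).mpr (Or.inr rfl)⟩, hGn _ (Or.inr rfl)]
      by_cases ht : t = none ∨ t = some i₀
      · rw [← h2 ⟨t, (fanOutLoc_eq_alice i₀ _).mpr ht⟩, hGn _ ht]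
      · have := h1 t fun h => ht ((fanOutLoc_eq_alice i₀ _).mp h)
        rw [hGs t ht, h0] at this
        simpa using this
    · intro h
      refine ⟨fun t ht => ?_, fun t => ?_⟩
      · rw [hGs t fun h => ht ((fanOutLoc_eq_alice i₀ _).mpr h), h, h]
        simp
      · rw [hGn _ ((fanOutLoc_eq_alice i₀ _).mp t.2), h]
  simp only [ghzVec, ← hb, ← and_or_left, ite_and]
  congr

theorem Run.fanOut {m : ℕ} {cc : Bool} (i₀ : Fin m) {cs : List (Channel m)}
    {o o' : PartyQubit m → Node m} {σ φ} (ho : ∀ t, o t = Node.router ↔ t ≠ none)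
    (h : Run (chanSrc m) (chanTgt m) cc cs o
      (pureState fun x => φ (ConferenceQKD.fanOut i₀ x)) o' σ) :
    Run (chanSrc m) (chanTgt m) cc cs o (pureState φ) o' σ := by
  refine Run.permute Node.router (fanOut_involutive i₀).toPerm
    (fun z t => if h : t.1 = some i₀ then z t else
      xor (z t) (z ⟨some i₀, (ho _).mpr (by simp)⟩)) ?_ h
  intro x t
  change ConferenceQKD.fanOut i₀ x t = _
  by_cases h : t = none
  · rw [dif_neg (by simp [ho, h])]
    exact if_pos (Or.inl h)
  · rw [dif_pos ((ho t).mpr h)]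
    simp only [ConferenceQKD.fanOut, h, false_or]
    split_ifs <;> rfl

theorem ghz_distributesInUses_one (cc : Bool) {m : ℕ} (hm : 1 ≤ m) :
    1 ∈ usesNQKD cc m := by
  refine ⟨[none :: (List.finRange m).map some], rfl, ?_, ?_⟩
  · simp only [List.mem_singleton, forall_eq, List.nodup_cons, List.mem_map, reduceCtorEq,
      and_false, exists_false, not_false_eq_true, true_and]
    exact (List.nodup_finRange m).map (Option.some_injective _)
  rw [List.flatten_singleton]
  obtain ⟨i₀⟩ : Nonempty (Fin m) := ⟨⟨0, hm⟩⟩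
  obtain ⟨o₁, hr, ha, ho₁⟩ : ∃ o₁ : PartyQubit m → Node m, (∀ t, o₁ t = Node.router ↔ t ≠ none) ∧
      o₁ none = Node.alice ∧ o₁ = @Function.update _ _ (fun _ _ => Classical.propDecidable _)
        (fanOutLoc i₀) (some i₀) Node.router :=
    ⟨_, @update_fanOutLoc_eq_router m (fun _ _ => Classical.propDecidable _) i₀,
      by simp [Function.update, fanOutLoc], rfl⟩
  -- The protocol is assembled from its end: first the deliveries to the Bobs, then, in front of
  -- them, the fan-out, Alice's transmission and her preparation.
  obtain ⟨o', h1, h2, h3⟩ := Run.distribute_some (cc := cc)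
    (Function.Embedding.some : Fin m ↪ PartyQubit m)
    (pureState (ghz m)) (List.finRange m) (List.nodup_finRange m) o₁
    fun i _ => (hr (some i)).mpr (by simp)
  have hloc : o' = partyLoc m := by
    funext t
    cases t with
    | none => rw [h2 none (by simp), ha]; rfl
    | some i => exact h1 i (List.mem_finRange i)
  rw [← hloc]
  rw [← funext (fanOut_ghzVec i₀)] at h3
  have h4 := Run.fanOut i₀ (φ := fun x => if ∀ t, fanOutLoc i₀ t ≠ Node.alice → x t = false then
      ghzVec {t // fanOutLoc i₀ t = Node.alice} (fun t => x t) else 0) hr h3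
  rw [ho₁] at h4
  have hne : Nonempty {q // fanOutLoc i₀ q = Node.alice} :=
    ⟨⟨none, (fanOutLoc_eq_alice i₀ _).mpr (Or.inl rfl)⟩⟩
  have h5 := Run.send none (some i₀) ((fanOutLoc_eq_alice i₀ _).mpr (Or.inr rfl)) h4
  rw [funext (fanOut_ghzVec i₀)] at h5
  refine Run.distributes (o := fanOutLoc i₀) ?_
  refine Run.prepare Node.alice (ghzVec _) (sum_norm_sq_ghzVec _) ?_
  convert h5 using 2

/-- For a product, nonzero amplitudes at the all-zero and all-one strings would force a nonzero
amplitude at the mixed string with Alice's bit one and all Bobs' bits zero. -/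
theorem ghz_not_hasSchmidtRankLE_one {m : ℕ} (hm : 1 ≤ m) :
    ¬ HasSchmidtRankLE (fun t => partyLoc m t = Node.alice) 1 (ghz m) := by
  rintro ⟨f, g, hf, hg, h⟩
  have hne : (1 / (Real.sqrt 2 : ℂ)) ≠ 0 := by simp
  have h0 : ghz m (fun _ => false) ≠ 0 := by
    rw [ghz, if_pos (Or.inl fun _ => rfl)]; exact hne
  have h1 : ghz m (fun _ => true) ≠ 0 := by
    rw [ghz, if_pos (Or.inr fun _ => rfl)]; exact hne
  have h2 : ghz m (fun t => t.isNone) = 0 := by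
    rw [ghz, if_neg]
    rintro (h | h)
    · simpa using h none
    · simpa using h (some ⟨0, hm⟩)
  rw [h, Fintype.sum_unique] at h0 h1 h2
  rw [hf _ _ (fun _ => true), hg _ _ (fun _ => false)] at h2
  · exact mul_ne_zero (left_ne_zero_of_mul h1) (right_ne_zero_of_mul h0) h2
  · intro t ht
    cases t with
    | none => exact absurd rfl ht
    | some i => rfl
  · intro t ht
    cases t with
    | none => rfl
    | some i => simp [partyLoc] at ht

theorem isLeast_usesNQKD (cc : Bool) {m : ℕ} (hm : 1 ≤ m) : IsLeast (usesNQKD cc m) 1 := by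
  refine ⟨ghz_distributesInUses_one cc hm, ?_⟩
  rintro n ⟨L, rfl, -, hL⟩
  by_contra hlt
  obtain rfl : L = [] := List.length_eq_zero_iff.mp (by omega)
  refine ghz_not_hasSchmidtRankLE_one hm ?_
  have := (hL.schmidt (· = Node.alice) (by rintro (_ | _) <;> simp [chanTgt])).2
  simpa using this

/-! ## Bell pairs -/

section Bell

variable {m : ℕ}

theorem bellPairs_apply (x : PairQubit m → Bool) :
    bellPairs m x = if ∀ i, x (i, false) = x (i, true) then (1 / (Real.sqrt 2 : ℂ)) ^ m else 0 := by
  rw [bellPairs, Finset.prod_ite_zero]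
  simp

theorem norm_one_div_sqrt_two_pow_sq : ‖(1 / (Real.sqrt 2 : ℂ)) ^ m‖ ^ 2 = (1 / 2) ^ m := by
  rw [norm_pow, ← pow_mul, mul_comm, pow_mul, norm_one_div_sqrt_two_sq]

theorem mem_alicePairQubits (t : PairQubit m) : t ∈ alicePairQubits m ↔ t.2 = false := by
  simp [alicePairQubits]

theorem card_alicePairQubits : (alicePairQubits m).card = m := by
  have : alicePairQubits m = (Finset.univ : Finset (Fin m)) ×ˢ {false} := by
    ext t
    rw [mem_alicePairQubits, Finset.mem_product]
    simp
  rw [this, Finset.card_product]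
  simp

/-- Each assignment of Alice's qubits has exactly one partner assignment, its copy, and all
amplitudes equal `2 ^ (-m / 2)`, so the spectrum is flat. -/
theorem bellPairs_norm_and_entropy : ∑ x, ‖bellPairs m x‖ ^ 2 = 1 ∧
    entanglementEntropy (alicePairQubits m) (bellPairs m) = m := by
  obtain ⟨τ, hτ⟩ : ∃ τ, τ = Function.Embedding.subtype (· ∈ alicePairQubits m) := ⟨_, rfl⟩
  have hmem : ∀ i, (i, false) ∈ alicePairQubits m := fun i => (mem_alicePairQubits _).mpr rfl
  have hτ' : ∀ q, q ∈ Set.range τ ↔ q.2 = false := by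
    intro q
    rw [hτ, Function.Embedding.coe_subtype, Subtype.range_coe_subtype]
    exact mem_alicePairQubits q
  let e₀ : ({q // q ∈ alicePairQubits m} → Bool) → {q // q ∉ Set.range τ} → Bool :=
    fun a q => a ⟨(q.1.1, false), hmem _⟩
  have he₀ : Function.Injective e₀ := by
    intro a a' h
    funext q
    obtain ⟨⟨i, b⟩, hq⟩ := q
    obtain rfl : b = false := (mem_alicePairQubits _).mp hq
    exact congrFun h ⟨(i, true), by simp [hτ']⟩
  have hA : ∀ a e i, glue τ a e (i, false) = a ⟨(i, false), hmem i⟩ := by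
    intro a e i
    have h : τ ⟨(i, false), hmem i⟩ = (i, false) := by rw [hτ]; rfl
    exact (congrArg (glue τ a e) h).symm.trans (glue_apply τ a e _)
  have hB : ∀ a e i (h : ((i, true) : PairQubit m) ∉ Set.range τ),
      glue τ a e (i, true) = e ⟨(i, true), h⟩ :=
    fun a e i h => glue_apply_of_notMem τ a e ⟨(i, true), h⟩
  have h1 : ∀ a, bellPairs m (glue τ a (e₀ a)) = (1 / (Real.sqrt 2 : ℂ)) ^ m := by
    intro a
    rw [bellPairs_apply, if_pos]
    intro i
    rw [hA, hB _ _ i (by simp [hτ'])]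
  have h2 : ∀ a e, e ≠ e₀ a → bellPairs m (glue τ a e) = 0 := by
    intro a e he
    rw [bellPairs_apply, if_neg]
    intro h
    apply he
    funext q
    obtain ⟨⟨i, b⟩, hq⟩ := q
    obtain rfl : b = true := by simpa [hτ'] using hq
    rw [← hB a e i hq, ← h, hA]
  subst hτ
  obtain ⟨h3, h4⟩ := entanglementEntropy_of_injective he₀ h1 h2
  rw [norm_one_div_sqrt_two_pow_sq, card_alicePairQubits] at h3 h4
  have hlog : Real.log 2 ≠ 0 := (Real.log_pos (by norm_num)).ne'
  constructor
  · rw [h3, ← mul_pow]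
    norm_num
  · rw [h4, Real.negMulLog, Real.log_pow, one_div, Real.log_inv, inv_pow]
    field_simp

/-- The pair of Alice and one Bob is in a Bell state. -/
theorem reduce_pairEmb (i : Fin m) :
    reduce (pairEmb m i) (pureState (bellPairs m)) = pureState (ghz 1) := by
  set τ := pairEmb m i with hτ
  have hτ0 : τ none = (i, false) := rfl
  have hτ1 : τ (some 0) = (i, true) := rfl
  have hoff : ∀ (j : Fin m) (b : Bool), j ≠ i → ((j, b) : PairQubit m) ∉ Set.range τ := by
    rintro j b hj ⟨t, ht⟩
    exact hj (congrArg Prod.fst ht).symm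
  -- The factor of the remaining pairs; the zero filling on the range of `τ` is never read.
  let β : ({q // q ∉ Set.range τ} → Bool) → ℂ := fun e =>
    ∏ j ∈ Finset.univ.erase i, if glue τ (fun _ => false) e (j, false) =
      glue τ (fun _ => false) e (j, true) then (1 / (Real.sqrt 2 : ℂ)) else 0
  have hfac : ∀ a e, bellPairs m (glue τ a e) = ghz 1 a * β e := by
    intro a e
    rw [bellPairs, ← Finset.mul_prod_erase _ _ (Finset.mem_univ i)]
    congr 1
    · rw [← hτ0, ← hτ1, glue_apply, glue_apply, ghz]
      have : (∀ t : PartyQubit 1, a t = false) ∨ (∀ t : PartyQubit 1, a t = true) ↔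
          a none = a (some 0) := by
        constructor
        · rintro (h | h) <;> rw [h, h]
        · intro h
          cases ha : a none with
          | false =>
            left
            rintro (_ | t)
            · exact ha
            · rw [Subsingleton.elim t 0, ← h, ha]
          | true =>
            right
            rintro (_ | t)
            · exact ha
            · rw [Subsingleton.elim t 0, ← h, ha]
      simp only [this]
    · refine Finset.prod_congr rfl fun j hj => ?_
      have hj' := Finset.ne_of_mem_erase hj
      have h : ∀ b, glue τ a e (j, b) = glue τ (fun _ => false) e (j, b) := fun b =>
        (glue_apply_of_notMem τ a e ⟨(j, b), hoff j b hj'⟩).trans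
          (glue_apply_of_notMem τ _ e ⟨(j, b), hoff j b hj'⟩).symm
      rw [h, h]
  exact reduce_pureState_of_eq_mul hfac (sum_norm_sq_ghz 1) bellPairs_norm_and_entropy.1

/-- Alice prepares all pairs locally, and use `i` carries her second qubit of pair `i` through the
router to Bob `i`. -/
theorem mem_uses2QKD (cc : Bool) (m : ℕ) : m ∈ uses2QKD cc m := by
  refine ⟨(List.finRange m).map fun i => [none, some i], by simp, ?_, ?_⟩
  · intro l hl
    obtain ⟨i, -, rfl⟩ := List.mem_map.mp hl
    simp
  obtain ⟨o', h1, h2, h3⟩ := Run.distribute_none_some (cc := cc)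
    (⟨fun i => (i, true), fun _ _ h => congrArg Prod.fst h⟩ : Fin m ↪ PairQubit m)
    (pureState (bellPairs m))
    (List.finRange m) (List.nodup_finRange m) (fun _ => Node.alice) fun _ _ => rfl
  have hloc : o' = pairLoc m := by
    funext t
    obtain ⟨i, b⟩ := t
    cases b with
    | false => exact h2 (i, false) fun j _ h => by simpa using congrArg Prod.snd h
    | true => exact h1 i (List.mem_finRange i)
  rw [← hloc]
  refine Run.distributes (o := fun _ => Node.alice) ?_
  refine Run.prepare Node.alice (fun z => bellPairs m fun q => z ⟨q, rfl⟩) ?_ ?_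
  · let E : ({q : PairQubit m // Node.alice (m := m) = Node.alice} → Bool) ≃ (PairQubit m → Bool) :=
      { toFun := fun z q => z ⟨q, rfl⟩
        invFun := fun x q => x q.1
        left_inv := fun _ => rfl
        right_inv := fun _ => rfl }
    rw [← (bellPairs_norm_and_entropy (m := m)).1]
    exact E.sum_comp fun x => ‖bellPairs m x‖ ^ 2
  · convert h3 using 2
    funext x
    simp

theorem countP_alice_router_le_count (L : List (Channel m)) :
    L.countP (fun c => chanSrc m c = Node.alice ∧ ¬ chanTgt m c = Node.alice) ≤ L.count none := by
  refine List.countP_mono_left fun c _ hc => ?_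
  cases c with
  | none => simp
  | some i => simp [chanSrc] at hc

theorem isLeast_uses2QKD (cc : Bool) (m : ℕ) : IsLeast (uses2QKD cc m) m := by
  refine ⟨mem_uses2QKD cc m, ?_⟩
  rintro n ⟨L, rfl, hnd, hL⟩
  have h := hL.entanglementEntropy_le (A := alicePairQubits m) (· = Node.alice)
    (by rintro (_ | _) <;> simp [chanTgt])
    (by rintro ⟨i, _ | _⟩ <;> simp [mem_alicePairQubits, pairLoc])
  rw [bellPairs_norm_and_entropy.2] at h
  have h' := Nat.cast_le.mp h
  refine h'.trans ?_
  -- Within one use the channels are distinct, so Alice's channel contributes at most one crossing.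
  rw [List.countP_flatten]
  refine (List.sum_le_card_nsmul _ 1 ?_).trans (by simp)
  intro x hx
  obtain ⟨l, hl, rfl⟩ := List.mem_map.mp hx
  exact (countP_alice_router_le_count l).trans (List.nodup_iff_count_le_one.mp (hnd l hl) none)

end Bell

/-! ## The parameters fix the GHZ state -/

section Parameters

variable {m : ℕ}

/-- The parity indicator is `(1 + (-1) ^ numY y) / 2`. The sign is a product over the parties, so
its sum factors into vanishing terms `1 - 1`. -/
theorem sum_ite_even_numY : (∑ y : PartyQubit m → Bool, if Even (numY y) then (1 : ℝ) else 0) =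
    2 ^ m := by
  have h1 : ∀ y : PartyQubit m → Bool, (if Even (numY y) then (1 : ℝ) else 0) =
      (1 + ∏ t, if y t then (-1 : ℝ) else 1) / 2 := by
    intro y
    have hprod : (∏ t, if y t then (-1 : ℝ) else 1) = (-1) ^ numY y := by
      rw [Finset.prod_ite, numY]
      simp
    rw [hprod]
    split_ifs with h
    · rw [h.neg_one_pow]; norm_num
    · rw [(Nat.not_even_iff_odd.mp h).neg_one_pow]; norm_num
  have h2 : ∑ y : PartyQubit m → Bool, ∏ t, (if y t then (-1 : ℝ) else 1) = 0 := by
    have := Finset.prod_univ_sum (fun _ : PartyQubit m => (Finset.univ : Finset Bool))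
      (fun _ b => if b then (-1 : ℝ) else 1)
    rw [Fintype.piFinset_univ] at this
    rw [← this, Finset.prod_eq_zero (Finset.mem_univ none)]
    simp
  simp only [h1]
  rw [← Finset.sum_div, Finset.sum_add_distrib, h2]
  simp [Fintype.card_option, pow_succ]

theorem const_ne : (fun _ : PartyQubit m => false) ≠ fun _ => true :=
  fun h => by simpa using congrFun h none

theorem sum_eq_of_const {M : Type} [AddCommMonoid M] {F : (PartyQubit m → Bool) → M}
    (hF : ∀ x, x ≠ (fun _ => false) → x ≠ (fun _ => true) → F x = 0) :
    ∑ x, F x = F (fun _ => false) + F (fun _ => true) :=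
  Fintype.sum_eq_add _ _ const_ne fun x hx => hF x hx.1 hx.2

/-- The depolarised expectation value of a state supported on the two constant assignments. -/
theorem depolarisedX_of_support {σ : QOp (PartyQubit m)}
    (h1 : ∀ x x', x ≠ (fun _ => false) → x ≠ (fun _ => true) → σ x x' = 0)
    (h2 : ∀ x x', x' ≠ (fun _ => false) → x' ≠ (fun _ => true) → σ x x' = 0) :
    depolarisedX σ = (σ (fun _ => false) (fun _ => true) + σ (fun _ => true) (fun _ => false)).re := by
  have hdiag : ∀ (y : PartyQubit m → Bool) (x : PartyQubit m → Bool), pauliXY y x x = 0 := by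
    intro y x
    rw [pauliXY, Matrix.of_apply]
    exact Finset.prod_eq_zero (Finset.mem_univ none) (by simp [pauliX, pauliY])
  -- Between opposite constant strings each `Y` contributes `-I` or `I` and each `X` contributes
  -- `1`. For an even number of `Y`'s the product is the sign that the definition of `depolarisedX`
  -- cancels.
  have hoff : ∀ (y : PartyQubit m → Bool), Even (numY y) →
      pauliXY y (fun _ => false) (fun _ => true) = (-1) ^ (numY y / 2) ∧
      pauliXY y (fun _ => true) (fun _ => false) = (-1) ^ (numY y / 2) := by
    intro y hy
    obtain ⟨j, hj⟩ := even_iff_two_dvd.mp hy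
    have hI : ∀ z : ℂ, z * z = -1 → (∏ t, if y t then z else 1) = (-1) ^ (numY y / 2) := by
      intro z hz
      have : (∏ t, if y t then z else 1) = z ^ numY y := by
        rw [Finset.prod_ite, numY]
        simp
      rw [this, hj, pow_mul, pow_two, hz, Nat.mul_div_cancel_left _ (by norm_num)]
    constructor
    · rw [← hI (-Complex.I) (by simp), pauliXY, Matrix.of_apply]
      simp [pauliX, pauliY]
    · rw [← hI Complex.I (by simp), pauliXY, Matrix.of_apply]
      simp [pauliX, pauliY]
  have htr : ∀ y : PartyQubit m → Bool, Even (numY y) → (σ * pauliXY y).trace =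
      (-1) ^ (numY y / 2) *
        (σ (fun _ => false) (fun _ => true) + σ (fun _ => true) (fun _ => false)) := by
    intro y hy
    obtain ⟨e1, e2⟩ := hoff y hy
    simp only [Matrix.trace, Matrix.diag_apply, Matrix.mul_apply]
    rw [sum_eq_of_const, sum_eq_of_const, sum_eq_of_const, hdiag, hdiag, e1, e2]
    · ring
    · intro x hx hx'
      rw [h2 _ _ hx hx', zero_mul]
    · intro x hx hx'
      rw [h2 _ _ hx hx', zero_mul]
    · intro x hx hx'
      exact Finset.sum_eq_zero fun x' _ => by rw [h1 _ _ hx hx', zero_mul]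
  have hterm : ∀ y : PartyQubit m → Bool,
      (if Even (numY y) then (-1 : ℝ) ^ (numY y / 2) * (Matrix.trace (σ * pauliXY y)).re else 0) =
      (if Even (numY y) then (1 : ℝ) else 0) *
        (σ (fun _ => false) (fun _ => true) + σ (fun _ => true) (fun _ => false)).re := by
    intro y
    split_ifs with hy
    · rw [htr y hy]
      have : ((-1 : ℂ) ^ (numY y / 2)) = (((-1 : ℝ) ^ (numY y / 2) : ℝ) : ℂ) := by
        push_cast; rfl
      rw [this, Complex.re_ofReal_mul, ← mul_assoc, ← mul_pow]
      norm_num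
    · simp
  rw [depolarisedX, Finset.sum_congr rfl fun y _ => hterm y, ← Finset.sum_mul, sum_ite_even_numY]
  field_simp

theorem ghz_false : ghz m (fun _ => false) = 1 / (Real.sqrt 2 : ℂ) := if_pos (Or.inl fun _ => rfl)

theorem ghz_true : ghz m (fun _ => true) = 1 / (Real.sqrt 2 : ℂ) := if_pos (Or.inr fun _ => rfl)

theorem ghz_eq_zero {x : PartyQubit m → Bool} (h0 : x ≠ fun _ => false) (h1 : x ≠ fun _ => true) :
    ghz m x = 0 :=
  if_neg fun h => h.elim (fun h => h0 (funext h)) fun h => h1 (funext h)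

theorem one_div_sqrt_two_mul_star :
    (1 / (Real.sqrt 2 : ℂ)) * star (1 / (Real.sqrt 2 : ℂ)) = 1 / 2 := by
  rw [Complex.star_def, Complex.mul_conj, Complex.normSq_eq_norm_sq, norm_one_div_sqrt_two_sq]
  norm_num

theorem ne_const_of_ne {x : PartyQubit m → Bool} {i : Fin m} (h : x (some i) ≠ x none) :
    x ≠ (fun _ => false) ∧ x ≠ fun _ => true := by
  constructor <;> rintro rfl <;> exact h rfl

theorem exists_ne_of_ne_const {x : PartyQubit m → Bool} (h0 : x ≠ fun _ => false)
    (h1 : x ≠ fun _ => true) : ∃ i, x (some i) ≠ x none := by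
  by_contra hall
  push Not at hall
  cases hn : x none with
  | false =>
    apply h0
    funext t
    cases t with
    | none => exact hn
    | some i => rw [hall, hn]
  | true =>
    apply h1
    funext t
    cases t with
    | none => exact hn
    | some i => rw [hall, hn]

theorem errZ_ghz : errZ (pureState (ghz m)) = 0 := by
  refine Finset.sum_eq_zero fun x _ => ?_
  split_ifs with h
  · obtain ⟨i, hi⟩ := h
    obtain ⟨h0, h1⟩ := ne_const_of_ne hi
    simp [pureState, ghz_eq_zero h0 h1]
  · rfl

theorem depolarisedX_ghz : depolarisedX (pureState (ghz m)) = 1 := by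
  rw [depolarisedX_of_support]
  · simp only [pureState, Matrix.of_apply, ghz_false, ghz_true, one_div_sqrt_two_mul_star]
    norm_num
  · intro x x' h0 h1
    simp [pureState, ghz_eq_zero h0 h1]
  · intro x x' h0 h1
    simp [pureState, ghz_eq_zero h0 h1]

/-- If the parameters are those of the GHZ state, then Eve's state factors out. -/
theorem eq_ghz_mul_of_sameParameters {d : ℕ} {ψ : (PartyQubit m → Bool) × Fin d → ℂ}
    (hψ : ∑ p, ‖ψ p‖ ^ 2 = 1) (h : SameParameters (honestState ψ) (pureState (ghz m))) :
    ∃ v : Fin d → ℂ, ∑ e, ‖v e‖ ^ 2 = 1 ∧ ∀ x e, ψ (x, e) = ghz m x * v e := by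
  obtain ⟨hZ, hX, -⟩ := h
  rw [errZ_ghz] at hZ
  have hdiag : ∀ x, (honestState ψ x x).re = ∑ e, ‖ψ (x, e)‖ ^ 2 := by
    intro x
    rw [honestState, Matrix.of_apply, Complex.re_sum]
    refine Finset.sum_congr rfl fun e _ => ?_
    rw [Complex.star_def, Complex.mul_conj, Complex.normSq_eq_norm_sq, Complex.ofReal_re]
  -- Since `Q_Z` is a sum of nonnegative weights, its vanishing kills the amplitude of every
  -- nonconstant string.
  have hsupp : ∀ x e, x ≠ (fun _ => false) → x ≠ (fun _ => true) → ψ (x, e) = 0 := by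
    intro x e h0 h1
    have h2 := (Finset.sum_eq_zero_iff_of_nonneg (fun x _ => by
      split_ifs
      · rw [hdiag]; positivity
      · exact le_rfl)).mp hZ x (Finset.mem_univ _)
    rw [if_pos (exists_ne_of_ne_const h0 h1), hdiag] at h2
    have h3 := (Finset.sum_eq_zero_iff_of_nonneg fun _ _ => by positivity).mp h2 e
      (Finset.mem_univ _)
    simpa using h3
  have hX' : depolarisedX (honestState ψ) = 1 := by
    rw [errX, errX, depolarisedX_ghz] at hX
    linarith
  rw [depolarisedX_of_support] at hX'
  rotate_left
  · intro x x' h0 h1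
    simp [honestState, hsupp x _ h0 h1]
  · intro x x' h0 h1
    simp [honestState, hsupp x' _ h0 h1]
  rw [Fintype.sum_prod_type, sum_eq_of_const] at hψ
  swap
  · intro x h0 h1
    simp [hsupp x _ h0 h1]
  -- The squared distance of Eve's two vectors is the total norm minus twice the real part of their
  -- inner product, that is, `1 - depolarisedX = 0`.
  have hcross : ∑ e, ‖ψ (fun _ => false, e) - ψ (fun _ => true, e)‖ ^ 2 = 0 := by
    have hn : ∀ a b : ℂ, ‖a - b‖ ^ 2 = ‖a‖ ^ 2 + ‖b‖ ^ 2 - (a * star b + b * star a).re := by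
      intro a b
      rw [← Complex.normSq_eq_norm_sq, ← Complex.normSq_eq_norm_sq, ← Complex.normSq_eq_norm_sq,
        Complex.normSq_sub]
      simp
      ring
    simp only [hn]
    rw [Finset.sum_sub_distrib, Finset.sum_add_distrib, hψ, ← hX', ← Complex.re_sum,
      Finset.sum_add_distrib]
    simp [honestState]
  have heq : ∀ e, ψ (fun _ => true, e) = ψ (fun _ => false, e) := by
    intro e
    have h3 := (Finset.sum_eq_zero_iff_of_nonneg fun _ _ => by positivity).mp hcross e
      (Finset.mem_univ _)
    have h4 : ψ (fun _ => false, e) - ψ (fun _ => true, e) = 0 := by simpa using h3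
    exact (sub_eq_zero.mp h4).symm
  have hs : (Real.sqrt 2 : ℂ) ≠ 0 := by simp
  refine ⟨fun e => Real.sqrt 2 * ψ (fun _ => false, e), ?_, ?_⟩
  · simp only [heq, norm_mul, mul_pow, Complex.norm_real] at hψ ⊢
    rw [Real.norm_of_nonneg (Real.sqrt_nonneg _), Real.sq_sqrt (by norm_num), ← Finset.mul_sum]
    linarith
  · intro x e
    by_cases h0 : x = fun _ => false
    · subst h0
      rw [ghz_false]
      field_simp
    · by_cases h1 : x = fun _ => true
      · subst h1
        rw [ghz_true, heq]
        field_simp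
      · rw [hsupp x e h0 h1, ghz_eq_zero h0 h1, zero_mul]

end Parameters

/-! ## The secret fraction of the GHZ state -/

section SecretFraction

variable {m d : ℕ} {ψ : (PartyQubit m → Bool) × Fin d → ℂ} {v : Fin d → ℂ}

theorem sum_mul_star_eq_one (hv : ∑ e, ‖v e‖ ^ 2 = 1) : ∑ e, v e * star (v e) = 1 := by
  have : ∑ e, v e * star (v e) = ((∑ e, ‖v e‖ ^ 2 : ℝ) : ℂ) := by
    simp [Complex.mul_conj, Complex.normSq_eq_norm_sq]
  rw [this, hv, Complex.ofReal_one]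

theorem honestState_of_eq_mul (hv : ∑ e, ‖v e‖ ^ 2 = 1) (h : ∀ x e, ψ (x, e) = ghz m x * v e) :
    honestState ψ = pureState (ghz m) := by
  ext x x'
  have : ∀ e, ψ (x, e) * star (ψ (x', e)) = (ghz m x * star (ghz m x')) * (v e * star (v e)) := by
    intro e
    rw [h, h, star_mul']
    ring
  simp only [honestState, pureState, Matrix.of_apply, this, ← Finset.mul_sum,
    sum_mul_star_eq_one hv, mul_one]

/-- Eve's state is `v v*`, whose entropy equals that of the one-by-one matrix `v* v = 1`. -/
theorem vonNeumannEntropy_eveState (hv : ∑ e, ‖v e‖ ^ 2 = 1)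
    (h : ∀ x e, ψ (x, e) = ghz m x * v e) : vonNeumannEntropy (eveState ψ) = 0 := by
  let W : Matrix (Fin d) Unit ℂ := Matrix.of fun e _ => v e
  have h1 : eveState ψ = W * Wᴴ := by
    ext e e'
    rw [eveState, Matrix.of_apply, sum_eq_of_const]
    · simp only [h, ghz_false, ghz_true, star_mul']
      have := one_div_sqrt_two_mul_star
      simp only [Matrix.mul_apply, Matrix.conjTranspose_apply, W, Matrix.of_apply,
        Finset.univ_unique, Finset.sum_singleton]
      linear_combination (2 * v e * star (v e')) * this
    · intro x h0 h1
      simp [h, ghz_eq_zero h0 h1]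
  have h2 : Wᴴ * W = Matrix.diagonal fun _ => ((1 : ℝ) : ℂ) := by
    ext i j
    rw [Subsingleton.elim j i, Matrix.diagonal_apply_eq, Complex.ofReal_one,
      ← sum_mul_star_eq_one hv]
    simp only [Matrix.mul_apply, Matrix.conjTranspose_apply, W, Matrix.of_apply, mul_comm]
  rw [h1, vonNeumannEntropy_mul_comm _ _ (Matrix.isHermitian_mul_conjTranspose_self _)
    (Matrix.isHermitian_conjTranspose_mul_self _), h2, vonNeumannEntropy_diagonal fun _ => (1 : ℝ)]
  simp [shannonEntropy]

variable {w : Bool → Bool → ℝ}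

/-- Eve's pure state factors out of the joint state. With `W` carrying the square roots of the
probabilities of `U`, it is `W W*`, while `W* W` is diagonal with exactly these probabilities. -/
theorem vonNeumannEntropy_bitEveState (hw : IsBitChannel w) (hv : ∑ e, ‖v e‖ ^ 2 = 1)
    (h : ∀ x e, ψ (x, e) = ghz m x * v e) : vonNeumannEntropy (bitEveState w ψ) =
      shannonEntropy fun u => (w false u + w true u) / 2 := by
  have hP : ∀ u, 0 ≤ (w false u + w true u) / 2 := fun u => by
    have := hw.1 false u
    have := hw.1 true u
    linarith
  let W : Matrix (Bool × Fin d) Bool ℂ := Matrix.of fun p u =>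
    if p.1 = u then (Real.sqrt ((w false u + w true u) / 2) : ℂ) * v p.2 else 0
  have hsq : ∀ u, (Real.sqrt ((w false u + w true u) / 2) : ℂ) *
      star (Real.sqrt ((w false u + w true u) / 2) : ℂ) = (((w false u + w true u) / 2 : ℝ) : ℂ) := by
    intro u
    rw [Complex.star_def, Complex.conj_ofReal, ← Complex.ofReal_mul, Real.mul_self_sqrt (hP u)]
  have h1 : bitEveState w ψ = W * Wᴴ := by
    ext ⟨u, e⟩ ⟨u', e'⟩
    rw [bitEveState, Matrix.of_apply, Matrix.mul_apply]
    simp only [Matrix.conjTranspose_apply, W, Matrix.of_apply, ite_mul, zero_mul]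
    rw [Finset.sum_ite_eq Finset.univ u, if_pos (Finset.mem_univ _)]
    by_cases hu : u = u'
    · subst hu
      rw [if_pos rfl, if_pos rfl, sum_eq_of_const]
      · simp only [h, ghz_false, ghz_true, star_mul']
        have h1 := one_div_sqrt_two_mul_star
        have h2 := hsq u
        push_cast at h2
        linear_combination (((w false u : ℂ) + w true u) * v e * star (v e')) * h1 -
          (v e * star (v e')) * h2
      · intro x h0 h1
        simp [h, ghz_eq_zero h0 h1]
    · rw [if_neg hu, if_neg fun h => hu h.symm, star_zero, mul_zero]
  have h2 : Wᴴ * W = Matrix.diagonal fun u => (((w false u + w true u) / 2 : ℝ) : ℂ) := by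
    ext u u'
    rw [Matrix.mul_apply, Fintype.sum_prod_type, Finset.sum_eq_single u]
    · by_cases hu : u = u'
      · subst hu
        rw [Matrix.diagonal_apply_eq, ← hsq, ← mul_one (_ * star _), ← sum_mul_star_eq_one hv,
          Finset.mul_sum]
        refine Finset.sum_congr rfl fun e _ => ?_
        simp only [Matrix.conjTranspose_apply, W, Matrix.of_apply, if_true, star_mul']
        ring
      · rw [Matrix.diagonal_apply_ne _ hu]
        simp [W, hu]
    · intro b _ hb
      simp [W, hb]
    · simp
  rw [h1, vonNeumannEntropy_mul_comm _ _ (Matrix.isHermitian_mul_conjTranspose_self _)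
    (Matrix.isHermitian_conjTranspose_mul_self _), h2,
    vonNeumannEntropy_diagonal fun u => (w false u + w true u) / 2]

theorem bitBobDist_ghz (i : Fin m) (p : Bool × Bool) :
    bitBobDist w (pureState (ghz m)) i p = w p.2 p.1 / 2 := by
  obtain ⟨u, b⟩ := p
  rw [bitBobDist, sum_eq_of_const]
  · simp only [pureState, Matrix.of_apply, ghz_false, ghz_true, one_div_sqrt_two_mul_star]
    cases b <;> norm_num
    · ring
    · ring
  · intro x h0 h1
    simp [pureState, ghz_eq_zero h0 h1]

/-- Bob's bit is uniform, which accounts for the subtracted `1`, and it equals Alice's bit, so his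
joint distribution with `U` is `w / 2`. -/
theorem condEntropyBob_ghz (hw : IsBitChannel w) (i : Fin m) :
    condEntropyBob w (pureState (ghz m)) i =
      shannonEntropy (fun p : Bool × Bool => w p.2 p.1 / 2) - 1 := by
  have hlog : Real.log 2 ≠ 0 := (Real.log_pos (by norm_num)).ne'
  have h1 : bitBobDist w (pureState (ghz m)) i = fun p => w p.2 p.1 / 2 :=
    funext (bitBobDist_ghz i)
  have h2 : (fun b => ∑ u, bitBobDist w (pureState (ghz m)) i (u, b)) = fun _ => (1 / 2 : ℝ) := by
    funext b
    rw [h1, ← Finset.sum_div, hw.2]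
  rw [condEntropyBob, h2, h1]
  congr 1
  rw [shannonEntropy, Real.negMulLog, one_div, Real.log_inv, Finset.sum_const]
  simp only [Finset.card_univ, Fintype.card_bool, nsmul_eq_mul]
  field_simp
  norm_num

theorem secretFraction_ghz (hm : 1 ≤ m) : secretFraction (pureState (ghz m)) = 1 := by
  have hlog : 0 < Real.log 2 := Real.log_pos (by norm_num)
  have hne : Nonempty (Fin m) := ⟨⟨0, hm⟩⟩
  -- `H(U) - H(U|K)` for a uniform bit `K`: the common value for all attacks compatible with the
  -- parameters.
  set I : (Bool → Bool → ℝ) → ℝ := fun w =>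
    shannonEntropy (fun u => (w false u + w true u) / 2) -
      (shannonEntropy (fun p : Bool × Bool => w p.2 p.1 / 2) - 1) with hI
  have hset : ∀ w, IsBitChannel w → {s : ℝ | ∃ (d : ℕ) (ψ : (PartyQubit m → Bool) × Fin d → ℂ),
      (∑ p, ‖ψ p‖ ^ 2 = 1) ∧ SameParameters (honestState ψ) (pureState (ghz m)) ∧
      s = condEntropyEve w ψ - ⨆ i : Fin m, condEntropyBob w (honestState ψ) i} = {I w} := by
    intro w hw
    have key : ∀ (d : ℕ) (ψ : (PartyQubit m → Bool) × Fin d → ℂ) (v : Fin d → ℂ),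
        ∑ e, ‖v e‖ ^ 2 = 1 → (∀ x e, ψ (x, e) = ghz m x * v e) →
        condEntropyEve w ψ - ⨆ i : Fin m, condEntropyBob w (honestState ψ) i = I w := by
      intro d ψ v hv h
      rw [condEntropyEve, vonNeumannEntropy_bitEveState hw hv h, vonNeumannEntropy_eveState hv h,
        honestState_of_eq_mul hv h]
      simp only [condEntropyBob_ghz hw, ciSup_const, sub_zero, hI]
    ext s
    constructor
    · rintro ⟨d, ψ, hψ, hpar, rfl⟩
      obtain ⟨v, hv, h⟩ := eq_ghz_mul_of_sameParameters hψ hpar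
      exact key d ψ v hv h
    · rintro rfl
      have hv : ∑ _e : Fin 1, ‖(1 : ℂ)‖ ^ 2 = 1 := by simp
      -- A one-dimensional Eve shows that the set is not empty; otherwise the real infimum would
      -- take its default value `0`.
      refine ⟨1, fun p => ghz m p.1, ?_, ?_, ?_⟩
      · rw [Fintype.sum_prod_type]
        simpa using sum_norm_sq_ghz m
      · rw [honestState_of_eq_mul (v := fun _ => 1) hv (by simp)]
        exact ⟨rfl, rfl, fun _ => rfl⟩
      · exact (key 1 _ (fun _ => 1) hv (by simp)).symm
  have hset' : {r : ℝ | ∃ w : Bool → Bool → ℝ, IsBitChannel w ∧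
      r = sInf {s : ℝ | ∃ (d : ℕ) (ψ : (PartyQubit m → Bool) × Fin d → ℂ),
      (∑ p, ‖ψ p‖ ^ 2 = 1) ∧ SameParameters (honestState ψ) (pureState (ghz m)) ∧
      s = condEntropyEve w ψ - ⨆ i : Fin m, condEntropyBob w (honestState ψ) i}} =
      {r : ℝ | ∃ w, IsBitChannel w ∧ r = I w} := by
    ext r
    refine exists_congr fun w => and_congr_right fun hw => ?_
    rw [hset w hw, csInf_singleton]
  rw [secretFraction, hset']
  -- The identity channel attains the value `1`.
  refine IsGreatest.csSup_eq ⟨⟨fun k u => if k = u then 1 else 0, ⟨?_, ?_⟩, ?_⟩, ?_⟩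
  · intro k u
    dsimp only
    split_ifs <;> norm_num
  · intro k
    simp
  · have h2 : Real.log (1 / 2) = -Real.log 2 := by rw [one_div, Real.log_inv]
    simp only [hI, shannonEntropy, Fintype.sum_prod_type, Fintype.sum_bool, Real.negMulLog]
    norm_num [h2]
  · rintro r ⟨w, hw, rfl⟩
    have hw1 : ∀ k, w k false + w k true = 1 := fun k => by
      have := hw.2 k
      rw [Fintype.sum_bool] at this
      linarith
    have hle : ∀ k u, w k u ≤ 1 := by
      intro k u
      have := hw1 k
      have := hw.1 k false
      have := hw.1 k true
      cases u <;> linarith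
    have hU : shannonEntropy (fun u => (w false u + w true u) / 2) ≤ 1 := by
      refine (shannonEntropy_le_logb (r := 2) (fun u => ?_) ?_ ?_).trans_eq ?_
      · have := hw.1 false u
        have := hw.1 true u
        linarith
      · rw [Fintype.sum_bool]
        have := hw1 false
        have := hw1 true
        linarith
      · exact (Fintype.card_subtype_le _).trans (by simp)
      · rw [Nat.cast_ofNat, Real.logb_self_eq_one (by norm_num)]
    -- Every joint probability is at most `1 / 2`, hence carries at least one bit of surprise;
    -- summing gives `H(U, K) ≥ 1`, and `H(U) ≤ 1` completes the bound.
    have hterm : ∀ k u, w k u / 2 * Real.log 2 ≤ Real.negMulLog (w k u / 2) := by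
      intro k u
      rcases (hw.1 k u).eq_or_lt with h0 | h0
      · simp [← h0]
      · have h1 : Real.log (w k u / 2) ≤ -Real.log 2 := by
          rw [Real.log_div h0.ne' (by norm_num)]
          have := Real.log_nonpos h0.le (hle k u)
          linarith
        rw [Real.negMulLog]
        nlinarith
    have hK : 1 ≤ shannonEntropy (fun p : Bool × Bool => w p.2 p.1 / 2) := by
      rw [shannonEntropy, le_div_iff₀ hlog, Fintype.sum_prod_type]
      simp only [Fintype.sum_bool]
      have h1 := hterm true true
      have h2 := hterm true false
      have h3 := hterm false true
      have h4 := hterm false false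
      have h5 := congrArg (· * Real.log 2) (hw1 false)
      have h6 := congrArg (· * Real.log 2) (hw1 true)
      linarith
    simp only [hI]
    linarith

end SecretFraction

end ConferenceQKD

/-! ### The main theorem -/

theorem mainTheorem5 (N : ℕ) (hN : 2 ≤ N) :
    -- moving one qubit across the cut raises the entropy of entanglement by at most 1
    (∀ (Q : Type) [Fintype Q] [DecidableEq Q] (ψ : (Q → Bool) → ℂ), ∑ x, ‖ψ x‖ ^ 2 = 1 →
      ∀ (A : Finset Q) (q : Q), q ∈ A →
        entanglementEntropy (A.erase q) ψ ≤ entanglementEntropy A ψ + 1) ∧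
    -- by sending qubits from `A` to `B` (all of `B` acting jointly), only pure states with entropy
    -- of entanglement at most the number of qubits sent can be distributed
    (∀ (cc : Bool) (cs : List Unit) (T : Type) [Fintype T] (A : Finset T) (loc : T → Side)
      (ψ : (T → Bool) → ℂ), (∀ t, t ∈ A ↔ loc t = Side.A) →
        Distributes cutSrc cutTgt cc cs loc (pureState ψ) →
          entanglementEntropy A ψ ≤ (cs.length : ℝ)) ∧
    -- `N - 1` Bell pairs have entropy of entanglement `N - 1`
    entanglementEntropy (alicePairQubits (N - 1)) (bellPairs (N - 1)) = (N : ℝ) - 1 ∧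
    -- hence a single qubit sent from Alice does not suffice, neither if the router and the Bobs act
    -- jointly, nor in the network, whatever the use of the channels from the router to the Bobs
    (3 ≤ N → ∀ (cc : Bool) (cs : List Unit), cs.length ≤ 1 →
      ¬ Distributes cutSrc cutTgt cc cs (fun t => side (pairLoc (N - 1) t))
        (pureState (bellPairs (N - 1)))) ∧
    (3 ≤ N → ∀ (cc : Bool) (cs : List (Channel (N - 1))), cs.count none ≤ 1 →
      ¬ Distributes (chanSrc (N - 1)) (chanTgt (N - 1)) cc cs (pairLoc (N - 1))
        (pureState (bellPairs (N - 1)))) ∧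
    -- the bipartite protocol needs exactly `N - 1` network uses, the multipartite one a single use
    (∀ cc : Bool, IsLeast (uses2QKD cc (N - 1)) (N - 1) ∧ IsLeast (usesNQKD cc (N - 1)) 1) ∧
    -- ideal key rates
    secretFractionNQKD (N - 1) = 1 ∧ secretFraction2QKD (N - 1) = 1 ∧
    (∀ cc : Bool, 0 < keyRate2QKD cc (N - 1) ∧
      keyRateNQKD cc (N - 1) = ((N : ℝ) - 1) * keyRate2QKD cc (N - 1)) := by

  have hm : 1 ≤ N - 1 := by omega
  have hcast : ((N - 1 : ℕ) : ℝ) = (N : ℝ) - 1 := by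
    rw [Nat.cast_sub (by omega), Nat.cast_one]
  have hne : Nonempty (Fin (N - 1)) := ⟨⟨0, hm⟩⟩
  have hcut : ∀ (cc : Bool) (cs : List Unit) (T : Type) [Fintype T] (A : Finset T)
      (loc : T → Side) (ψ : (T → Bool) → ℂ), (∀ t, t ∈ A ↔ loc t = Side.A) →
      Distributes cutSrc cutTgt cc cs loc (pureState ψ) →
      entanglementEntropy A ψ ≤ (cs.length : ℝ) := by
    intro cc cs T _ A loc ψ hA h
    exact (h.entanglementEntropy_le (· = Side.A) (fun _ _ => rfl) hA).trans
      (by exact_mod_cast List.countP_le_length)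
  have hbell : entanglementEntropy (alicePairQubits (N - 1)) (bellPairs (N - 1)) = (N : ℝ) - 1 := by
    rw [bellPairs_norm_and_entropy.2, hcast]
  have hfrac : secretFractionNQKD (N - 1) = 1 := secretFraction_ghz hm
  have hfrac2 : secretFraction2QKD (N - 1) = 1 := by
    -- A Bell pair is the GHZ state with one Bob, so all terms of the minimum equal `1`; `hne`
    -- excludes the empty infimum.
    simp only [secretFraction2QKD, reduce_pairEmb, secretFraction_ghz le_rfl, ciInf_const]
  refine ⟨?_, hcut, hbell, ?_, ?_, fun cc => ⟨isLeast_uses2QKD cc _, isLeast_usesNQKD cc hm⟩,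
    hfrac, hfrac2, fun cc => ?_⟩
  · intro Q _ _ ψ hψ A q hq
    exact entanglementEntropy_erase_le hq hψ
  · intro hN3 cc cs hcs h
    have h1 := hcut cc cs _ (alicePairQubits (N - 1)) _ _
      (by rintro ⟨i, _ | _⟩ <;> simp [mem_alicePairQubits, pairLoc, side]) h
    rw [bellPairs_norm_and_entropy.2] at h1
    have := Nat.cast_le.mp h1
    omega
  · intro hN3 cc cs hcs h
    have h1 := h.entanglementEntropy_le (A := alicePairQubits (N - 1)) (· = Node.alice)
      (by rintro (_ | _) <;> simp [chanTgt])
      (by rintro ⟨i, _ | _⟩ <;> simp [mem_alicePairQubits, pairLoc])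
    rw [bellPairs_norm_and_entropy.2] at h1
    have h2 := (Nat.cast_le.mp h1).trans (countP_alice_router_le_count cs)
    omega
  -- With both secret fractions equal to `1`, the rates are `1 / (N - 1)` and `1 / 1`.
  · rw [keyRate2QKD, keyRateNQKD, hfrac, hfrac2, (isLeast_uses2QKD cc _).csInf_eq,
      (isLeast_usesNQKD cc hm).csInf_eq, hcast]
    have : (0 : ℝ) < (N : ℝ) - 1 := by
      rw [← hcast]
      exact_mod_cast hm
    constructor
    · positivity
    · field_simp
      simp
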